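/- Theorem (PBW theorem for restricted Lie-Rinehart algebras). Let $p$ be a prime and let $K$ be a commutative ring of characteristic $p$. All algebras are over $K$; associative algebras are unital. A restricted Lie algebra over $K$ is a $K$-Lie algebra $L$ with a map $x\mapsto x^{[p]}$ on $L$ such that $(ax)^{[p]}=a^px^{[p]}$, $[x^{[p]},y]=\operatorname{ad}(x)^p(y)$ and $(x+y)^{[p]}=x^{[p]}+y^{[p]}+\sum_{i=1}^{p-1}s_i(x,y)$ for $a\in K$ and $x,y\in L$, where $i\,s_i(x,y)$ is the coefficient of $t^{i-1}$ in $\operatorname{ad}(tx+y)^{p-1}(x)$. An associative algebra is a restricted Lie algebra with the commutator and the $p$-th power. Let $R$ be a commutative $K$-algebra. A Lie-Rinehart algebra $(R,L)$ is a $K$-Lie algebra $L$ which is also an $R$-module (compatibly with its $K$-module structure), with an $R$-linear $K$-Lie algebra homomorphism $\epsilon\colon L\to\operatorname{Der}_K(R)$ such that $[x,ry]=r[x,y]+\epsilon(x)(r)\,y$ for $x,y\in L$, $r\in R$. It is restricted if $L$ is a restricted Lie algebra over $K$ such that $(rx)^{[p]}=r^px^{[p]}+\epsilon(rx)^{p-1}(r)\,x$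 for $x\in L$, $r\in R$. The restricted universal enveloping algebra $u(R,L)$ of a restricted Lie-Rinehart algebra $(R,L)$ is the associative algebra with an algebra map $\iota_R\colon R\to u(R,L)$ and a homomorphism of restricted Lie algebras $\iota_L\colon L\to u(R,L)$ satisfying $\iota_R(r)\iota_L(x)=\iota_L(rx)$ and $\iota_L(x)\iota_R(r)-\iota_R(r)\iota_L(x)=\iota_R(\epsilon(x)(r))$ for $x\in L$, $r\in R$, which is universal among such triples. It is a left $R$-module through $\iota_R$. Let $(R,L)$ be a restricted Lie-Rinehart algebra in characteristic $p$. (1) If $L$ is a free $R$-module with basis $(x_i)_{i\in I}$, where $I$ is totally ordered, then $u(R,L)$ is a free left $R$-module with basis the ordered monomials $\iota_L(x_{i_1})^{e_1}\cdots\iota_L(x_{i_\ell})^{e_\ell}$ with $\ell\ge 0$, $i_1<\dots<i_\ell$ in $I$ and $1\le e_j<p$ for $1\le j\le \ell$. (2) If $L$ is a projective $R$-module, then $u(R,L)$ is a locally free left $R$-module, that is, for every prime ideal $\mathfrak p$ of $R$ the localization $R_{\mathfrak p}\otimes_R u(R,L)$ is a free $R_{\mathfrak p}$-module. (3) If $L$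 is a finitely generated projective $R$-module, then $u(R,L)$ is finitely generated and projective as a left $R$-module. -/

import Mathlib

open Polynomial

/-- `restrictedCoeff K p i x y` is Jacobson's Lie polynomial `s_i(x, y)`: for `1 ≤ i < p`,
`i • s_i(x, y)` is the coefficient of `t ^ (i - 1)` in `ad (t x + y) ^ (p - 1) x`.
Here `t = X` is a formal variable commuting with the endomorphisms of `L`, and `Ring.inverse`
is the honest inverse, since `i` is a unit of `K` when `K` has prime characteristic `p`. -/
noncomputable def restrictedCoeff (K : Type*) {L : Type*} [CommRing K] [LieRing L]
    [LieAlgebra K L] (p i : ℕ) (x y : L) : L :=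
  Ring.inverse (i : K) •
    (((X * C (LieAlgebra.ad K L x) + C (LieAlgebra.ad K L y) : (Module.End K L)[X]) ^
      (p - 1)).coeff (i - 1)) x

/-- A restricted Lie algebra over `K` (to be used with `K` of prime characteristic `p`):
a Lie algebra with a `p`-operation `x ↦ x^[p]`. -/
class RestrictedLieAlgebra (p : ℕ) (K L : Type*) [CommRing K] [LieRing L]
    [LieAlgebra K L] where
  /-- The `p`-operation `x ↦ x^[p]`. -/
  pMap : L → L
  pMap_smul : ∀ (a : K) (x : L), pMap (a • x) = a ^ p • pMap x
  pMap_lie : ∀ x y : L, ⁅pMap x, y⁆ = (LieAlgebra.ad K L x ^ p) y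
  pMap_add : ∀ x y : L,
    pMap (x + y) = pMap x + pMap y + ∑ i ∈ Finset.Ico 1 p, restrictedCoeff K p i x y

/-- A restricted Lie-Rinehart algebra `(R, L)`: a Lie-Rinehart algebra over `K` such that `L` is a
restricted Lie algebra over `K`, with Hochschild's compatibility
`(r x)^[p] = r ^ p x^[p] + (r x) ^ (p - 1) (r) x`, where `r x` acts on `R` through the anchor. -/
class RestrictedLieRinehartAlgebra (p : ℕ) (K R L : Type*) [CommRing K] [CommRing R]
    [Algebra K R] [LieRing L] [LieAlgebra K L] [Module R L] [LieRingModule L R]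
    [LieRinehartRing R L] [LieRinehartAlgebra K R L] [RestrictedLieAlgebra p K L] : Prop where
  pMap_smul_ring : ∀ (r : R) (x : L),
    RestrictedLieAlgebra.pMap p K (r • x) =
      r ^ p • RestrictedLieAlgebra.pMap p K x +
        (LieModule.toEnd K L R (r • x) ^ (p - 1)) r • x

section

variable (p : ℕ) (K R L : Type*) [CommRing K] [CommRing R] [Algebra K R] [LieRing L]
  [LieAlgebra K L] [Module R L] [LieRingModule L R] [RestrictedLieAlgebra p K L]

/-- The conditions on the triples `(A, i_R, i_L)` among which the restricted universal enveloping
algebra is universal: `A` is an associative unital `K`-algebra, `i_R` a `K`-algebra map, and `i_L`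
a map of restricted Lie algebras to `A` (with the commutator and the `p`-th power), such that
`i_R(r) i_L(x) = i_L(r x)` and `i_L(x) i_R(r) - i_R(r) i_L(x) = i_R(ε(x)(r))`. -/
structure IsRestrictedTriple {A : Type*} [Ring A] [Algebra K A]
    (iR : R →ₐ[K] A) (iL : L →ₗ[K] A) : Prop where
  map_lie : ∀ x y : L, iL ⁅x, y⁆ = iL x * iL y - iL y * iL x
  map_pMap : ∀ x : L, iL (RestrictedLieAlgebra.pMap p K x) = iL x ^ p
  map_smul : ∀ (r : R) (x : L), iR r * iL x = iL (r • x)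
  map_anchor : ∀ (x : L) (r : R), iL x * iR r - iR r * iL x = iR ⁅x, r⁆

namespace RestrictedEnvelopingAlgebra

/-- The defining relations of the restricted universal enveloping algebra, in the free algebra on
symbols `r` (for `r ∈ R`) and `x` (for `x ∈ L`). -/
inductive Rel : FreeAlgebra K (R ⊕ L) → FreeAlgebra K (R ⊕ L) → Prop
  | ring_add (r s : R) : Rel (FreeAlgebra.ι K (Sum.inl (r + s)))
      (FreeAlgebra.ι K (Sum.inl r) + FreeAlgebra.ι K (Sum.inl s))
  | ring_mul (r s : R) : Rel (FreeAlgebra.ι K (Sum.inl (r * s)))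
      (FreeAlgebra.ι K (Sum.inl r) * FreeAlgebra.ι K (Sum.inl s))
  | ring_algebraMap (a : K) : Rel (FreeAlgebra.ι K (Sum.inl (algebraMap K R a)))
      (algebraMap K (FreeAlgebra K (R ⊕ L)) a)
  | lie_add (x y : L) : Rel (FreeAlgebra.ι K (Sum.inr (x + y)))
      (FreeAlgebra.ι K (Sum.inr x) + FreeAlgebra.ι K (Sum.inr y))
  | lie_smul (a : K) (x : L) : Rel (FreeAlgebra.ι K (Sum.inr (a • x)))
      (a • FreeAlgebra.ι K (Sum.inr x))
  | lie_bracket (x y : L) : Rel (FreeAlgebra.ι K (Sum.inr ⁅x, y⁆))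
      (FreeAlgebra.ι K (Sum.inr x) * FreeAlgebra.ι K (Sum.inr y) -
        FreeAlgebra.ι K (Sum.inr y) * FreeAlgebra.ι K (Sum.inr x))
  | lie_pMap (x : L) : Rel (FreeAlgebra.ι K (Sum.inr (RestrictedLieAlgebra.pMap p K x)))
      (FreeAlgebra.ι K (Sum.inr x) ^ p)
  | ring_smul (r : R) (x : L) :
      Rel (FreeAlgebra.ι K (Sum.inl r) * FreeAlgebra.ι K (Sum.inr x))
        (FreeAlgebra.ι K (Sum.inr (r • x)))
  | anchor (x : L) (r : R) :
      Rel (FreeAlgebra.ι K (Sum.inr x) * FreeAlgebra.ι K (Sum.inl r) -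
          FreeAlgebra.ι K (Sum.inl r) * FreeAlgebra.ι K (Sum.inr x))
        (FreeAlgebra.ι K (Sum.inl ⁅x, r⁆))

end RestrictedEnvelopingAlgebra

/-- The restricted universal enveloping algebra `u(R, L)`. -/
def RestrictedEnvelopingAlgebra : Type _ :=
  RingQuot (RestrictedEnvelopingAlgebra.Rel p K R L)

namespace RestrictedEnvelopingAlgebra

noncomputable instance : Ring (RestrictedEnvelopingAlgebra p K R L) :=
  inferInstanceAs (Ring (RingQuot (Rel p K R L)))

noncomputable instance : Algebra K (RestrictedEnvelopingAlgebra p K R L) :=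
  inferInstanceAs (Algebra K (RingQuot (Rel p K R L)))

/-- The quotient map from the free algebra. -/
noncomputable def mk : FreeAlgebra K (R ⊕ L) →ₐ[K] RestrictedEnvelopingAlgebra p K R L :=
  RingQuot.mkAlgHom K (Rel p K R L)

variable {K R L} in
theorem mk_rel {a b : FreeAlgebra K (R ⊕ L)} (h : Rel p K R L a b) :
    mk p K R L a = mk p K R L b :=
  RingQuot.mkAlgHom_rel K h

/-- The structure map `ι_R : R → u(R, L)`. -/
noncomputable def ιR : R →ₐ[K] RestrictedEnvelopingAlgebra p K R L where
  toFun r := mk p K R L (FreeAlgebra.ι K (Sum.inl r))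
  map_one' := by
    have h := mk_rel p (Rel.ring_algebraMap (p := p) (R := R) (L := L) (1 : K))
    simpa using h
  map_mul' r s := by rw [mk_rel p (Rel.ring_mul r s), map_mul]
  map_zero' := by
    have h := mk_rel p (Rel.ring_algebraMap (p := p) (R := R) (L := L) (0 : K))
    simpa using h
  map_add' r s := by rw [mk_rel p (Rel.ring_add r s), map_add]
  commutes' a := by rw [mk_rel p (Rel.ring_algebraMap a), AlgHom.commutes]

/-- The structure map `ι_L : L → u(R, L)`. -/
noncomputable def ιL : L →ₗ[K] RestrictedEnvelopingAlgebra p K R L where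
  toFun x := mk p K R L (FreeAlgebra.ι K (Sum.inr x))
  map_add' x y := by rw [mk_rel p (Rel.lie_add x y), map_add]
  map_smul' a x := by rw [mk_rel p (Rel.lie_smul a x), _root_.map_smul, RingHom.id_apply]

theorem isRestrictedTriple : IsRestrictedTriple p K R L (ιR p K R L) (ιL p K R L) where
  map_lie x y := by
    change mk p K R L _ = mk p K R L _ * mk p K R L _ - mk p K R L _ * mk p K R L _
    rw [mk_rel p (Rel.lie_bracket x y), map_sub, map_mul, map_mul]
  map_pMap x := by
    change mk p K R L _ = mk p K R L _ ^ p
    rw [mk_rel p (Rel.lie_pMap x), map_pow]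
  map_smul r x := by
    change mk p K R L _ * mk p K R L _ = mk p K R L _
    rw [← map_mul, mk_rel p (Rel.ring_smul r x)]
  map_anchor x r := by
    change mk p K R L _ * mk p K R L _ - mk p K R L _ * mk p K R L _ = mk p K R L _
    rw [← map_mul, ← map_mul, ← map_sub, mk_rel p (Rel.anchor x r)]

variable {K R L} in
/-- The universal property of `(u(R, L), ι_R, ι_L)`. -/
theorem existsUnique_lift {A : Type*} [Ring A] [Algebra K A]
    {iR : R →ₐ[K] A} {iL : L →ₗ[K] A} (h : IsRestrictedTriple p K R L iR iL) :
    ∃! f : RestrictedEnvelopingAlgebra p K R L →ₐ[K] A,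
      (∀ r, f (ιR p K R L r) = iR r) ∧ ∀ x, f (ιL p K R L x) = iL x := by
  let g : FreeAlgebra K (R ⊕ L) →ₐ[K] A := FreeAlgebra.lift K (Sum.elim iR iL)
  have hg : ∀ ⦃a b⦄, Rel p K R L a b → g a = g b := by
    intro a b hab
    cases hab with
    | anchor x r => simpa [g] using h.map_anchor x r
    | _ => simp [g, h.map_lie, h.map_pMap, h.map_smul]
  refine ⟨RingQuot.liftAlgHom K ⟨g, hg⟩, ⟨fun r => ?_, fun x => ?_⟩, ?_⟩
  · change RingQuot.liftAlgHom K ⟨g, hg⟩ (RingQuot.mkAlgHom K (Rel p K R L) _) = _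
    rw [RingQuot.liftAlgHom_mkAlgHom_apply]
    simp [g]
  · change RingQuot.liftAlgHom K ⟨g, hg⟩ (RingQuot.mkAlgHom K (Rel p K R L) _) = _
    rw [RingQuot.liftAlgHom_mkAlgHom_apply]
    simp [g]
  · rintro f ⟨hR, hL⟩
    apply RingQuot.ringQuot_ext'
    apply FreeAlgebra.hom_ext
    funext a
    change f (mk p K R L (FreeAlgebra.ι K a)) =
      RingQuot.liftAlgHom K ⟨g, hg⟩ (RingQuot.mkAlgHom K (Rel p K R L) (FreeAlgebra.ι K a))
    rw [RingQuot.liftAlgHom_mkAlgHom_apply]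
    cases a with
    | inl r => exact (hR r).trans (by simp [g])
    | inr x => exact (hL x).trans (by simp [g])

/-- `u(R, L)` as a left `R`-module: `r` acts as left multiplication by `ι_R(r)`. -/
noncomputable instance : Module R (RestrictedEnvelopingAlgebra p K R L) :=
  Module.compHom _ (ιR p K R L).toRingHom

theorem ring_smul_def (r : R) (a : RestrictedEnvelopingAlgebra p K R L) :
    r • a = ιR p K R L r * a := rfl

variable {L} in
/-- The ordered monomial `ι_L(x_{i₁}) ^ e_{i₁} ⋯ ι_L(x_{iₗ}) ^ e_{iₗ}`, where `i₁ < ⋯ < iₗ` are the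
indices with nonzero exponent. -/
noncomputable def orderedMonomial {I : Type*} [LinearOrder I] (x : I → L) (e : I →₀ ℕ) :
    RestrictedEnvelopingAlgebra p K R L :=
  ((e.support.sort (· ≤ ·)).map fun i => ιL p K R L (x i) ^ e i).prod

end RestrictedEnvelopingAlgebra

end

/-- A module over a commutative ring is locally free if its localization at each prime ideal `P`
is free over the local ring at `P`. -/
def IsLocallyFreeModule (R M : Type*) [CommRing R] [AddCommGroup M] [Module R M] : Prop :=
  ∀ (P : Ideal R) [P.IsPrime],
    Module.Free (Localization.AtPrime P) (LocalizedModule P.primeCompl M)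

/-! ### Jacobson's formula for `p`-th powers of sums. -/

section CharPAlgebra

/-! The heart of the proof is a diamond lemma with coefficients on which `L` acts by derivations.
Let `S` be `R` or a localization of `R` over which `L` becomes free on the images of elements `x i`
of `L` (`PBWDatum`). Each `y` in `L` acts on the free `S`-module on words in `I` by `op y`, which
prepends the coordinates of `y` as letters and differentiates the coefficients along the anchor. The
bracket and `p`-power relations fail by `lieDefect` and `powDefect`; these are `S`-linear because
the derivation terms cancel. They are read as rewriting rules for the words `ij` with `j < i` and
`i^p`, with words compared by length and, among permutations, by inversions.

The overlaps resolve (`IsRedex.sub_mem`): `ijk` by the Jacobi identity, `i^p j` and `i j^p` by the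
characteristic `p` identities `ad(a)^p = [a^p, ·]` and `ad(a)^(p-1)(b) = ∑ a^k b a^(p-1-k)`, and
`i^(p+m)` because `[x^[p], x] = 0`. Hence there is a normal form map fixing the irreducible words,
which are exactly the increasing words with all multiplicities below `p`.

To compare with `S ⊗ u(R, L)`, the quotient of the word module by the relations is made into a
restricted triple. Its `p`-power relation is imposed only at the `x i`; Jacobson's formula for `(x +
y)^p` and Hochschild's for `(r x)^p` extend it to all of `L` (`opQuot_pow`). The universal property
then inverts the evident map from the quotient to `S ⊗ u(R, L)`, which gives
`PBWDatum.exists_basis`.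

For free `L`, take `S = R`. For projective `L`, the localization of `L` at a prime is free by
Kaplansky's theorem, proved here without any rank restriction. If `L` is moreover finitely
generated, it is free on basic open sets covering the spectrum; there `u(R, L)` is finite free, so
it is finitely presented, and projective because it is so locally. -/

theorem charP_of_natCast_eq_zero {A : Type*} [Ring A] [Nontrivial A] {p : ℕ} (hp : p.Prime)
    (h : (p : A) = 0) : CharP A p := by
  have h1 : ringChar A ∣ p := ringChar.dvd h
  rcases (Nat.dvd_prime hp).1 h1 with h2 | h2
  · exact absurd h2 CharP.ringChar_ne_one
  · exact ringChar.of_eq h2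

theorem sub_pow_of_commute_of_natCast_eq_zero {A : Type*} [Ring A] {p : ℕ} (hp : p.Prime)
    (h : (p : A) = 0) {a b : A} (hab : Commute a b) : (a - b) ^ p = a ^ p - b ^ p := by
  nontriviality A
  have := Fact.mk hp
  have := charP_of_natCast_eq_zero hp h
  exact sub_pow_char_of_commute p hab

/-- Pascal's rule gives `choose p (k+1)`, which vanishes modulo `p`, as the sum of two neighbours in
row `p - 1`; so this row alternates in sign. -/
theorem natCast_choose_pred {A : Type*} [Ring A] {p : ℕ} (hp : p.Prime) (h : (p : A) = 0)
    {k : ℕ} (hk : k < p) : (((p - 1).choose k : ℕ) : A) = (-1) ^ k := by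
  induction k with
  | zero => simp
  | succ k ih =>
    have h1 : p.choose (k + 1) = (p - 1).choose k + (p - 1).choose (k + 1) := by
      conv_lhs => rw [← Nat.sub_add_cancel hp.one_le]
      exact Nat.choose_succ_succ _ _
    have h2 : ((p.choose (k + 1) : ℕ) : A) = 0 := by
      obtain ⟨c, hc⟩ := hp.dvd_choose_self (Nat.succ_ne_zero k) hk
      rw [hc, Nat.cast_mul, h, zero_mul]
    rw [h1, Nat.cast_add, ih (by omega)] at h2
    rw [pow_succ, eq_neg_of_add_eq_zero_right h2, mul_neg_one]

theorem neg_one_pow_pred {A : Type*} [Ring A] {p : ℕ} (hp : p.Prime) (h : (p : A) = 0) :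
    (-1 : A) ^ (p - 1) = 1 := by
  have := natCast_choose_pred hp h (k := p - 1) (by have := hp.pos; omega)
  simpa using this.symm

/-- The binomial coefficients `(-1)^k` absorb the signs of `-b`, because `(-1)^(p-1) = 1`, also for
`p = 2`. -/
theorem sub_pow_pred_of_commute {A : Type*} [Ring A] {p : ℕ} (hp : p.Prime) (h : (p : A) = 0)
    {a b : A} (hab : Commute a b) :
    (a - b) ^ (p - 1) = ∑ k ∈ Finset.range p, a ^ k * b ^ (p - 1 - k) := by
  have hpp := hp.pos
  rw [sub_eq_add_neg, (hab.neg_right).add_pow, Nat.sub_add_cancel hp.one_le]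
  refine Finset.sum_congr rfl fun k hk => ?_
  have hk := Finset.mem_range.1 hk
  rw [natCast_choose_pred hp h hk, neg_pow b, mul_assoc, mul_assoc,
    ((Commute.neg_one_left (b ^ (p - 1 - k))).pow_left k).symm.eq, ← mul_assoc ((-1) ^ _),
    ← pow_add, Nat.sub_add_cancel (by omega), neg_one_pow_pred hp h, one_mul]

attribute [local instance] LieRing.ofAssociativeRing

variable {K A : Type*} [CommRing K] [Ring A] [Algebra K A] {p : ℕ}

/-- `ad a` is the difference of left and right multiplication by `a`; these commute, so the
Frobenius identity applies in the endomorphism ring. -/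
theorem LieAlgebra.ad_pow_char_apply (hp : p.Prime) (h : (p : A) = 0) (a y : A) :
    (LieAlgebra.ad K A a ^ p) y = a ^ p * y - y * a ^ p := by
  have h1 : (p : Module.End K A) = 0 := by
    ext y
    rw [Module.End.natCast_apply, ← Nat.cast_smul_eq_nsmul A, h]; simp
  have h2 : LieAlgebra.ad K A a = LinearMap.mulLeft K a - LinearMap.mulRight K a :=
    congrFun (LieAlgebra.ad_eq_lmul_left_sub_lmul_right (R := K) A) a
  rw [h2, sub_pow_of_commute_of_natCast_eq_zero hp h1 (LinearMap.commute_mulLeft_right a a)]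
  simp [LinearMap.pow_mulLeft, LinearMap.pow_mulRight]

theorem LieAlgebra.ad_pow_pred_char_apply (hp : p.Prime) (h : (p : A) = 0) (a y : A) :
    (LieAlgebra.ad K A a ^ (p - 1)) y =
      ∑ k ∈ Finset.range p, a ^ k * y * a ^ (p - 1 - k) := by
  have h1 : (p : Module.End K A) = 0 := by
    ext y
    rw [Module.End.natCast_apply, ← Nat.cast_smul_eq_nsmul A, h]; simp
  have h2 : LieAlgebra.ad K A a = LinearMap.mulLeft K a - LinearMap.mulRight K a :=
    congrFun (LieAlgebra.ad_eq_lmul_left_sub_lmul_right (R := K) A) a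
  rw [h2, sub_pow_pred_of_commute hp h1 (LinearMap.commute_mulLeft_right a a)]
  simp [LinearMap.pow_mulLeft, LinearMap.pow_mulRight, mul_assoc]

theorem Polynomial.derivative_pow_eq_sum (q : A[X]) (n : ℕ) :
    derivative (q ^ n) = ∑ k ∈ Finset.range n, q ^ k * derivative q * q ^ (n - 1 - k) := by
  induction n with
  | zero => simp
  | succ n ih =>
    rw [pow_succ, derivative_mul, ih, Finset.sum_range_succ, Finset.sum_mul]
    simp only [Nat.add_sub_cancel, Nat.sub_self, pow_zero, mul_one]
    congr 1
    refine Finset.sum_congr rfl fun k hk => ?_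
    have hk := Finset.mem_range.1 hk
    rw [mul_assoc _ _ q, ← pow_succ]
    congr 2
    omega

/-- `restrictedCoeff` uses polynomials over endomorphisms, which make sense for any Lie algebra. In
the associative case this passes to `A[X]`, where `X x + y` can be raised to powers and
differentiated. -/
theorem Polynomial.coeff_ad_pow_apply (x y z : A) (n k : ℕ) :
    ((((X * C (LieAlgebra.ad K A x) + C (LieAlgebra.ad K A y) : (Module.End K A)[X]) ^ n).coeff k)
      z) = (((LieAlgebra.ad K A[X] (X * C x + C y)) ^ n) (C z)).coeff k := by
  induction n generalizing k with
  | zero => by_cases hk : k = 0 <;> simp [coeff_one, coeff_C, hk]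
  | succ n ih =>
    rw [pow_succ', pow_succ', Module.End.mul_apply, LieAlgebra.ad_apply, Ring.lie_def]
    generalize (X * C (LieAlgebra.ad K A x) + C (LieAlgebra.ad K A y) : (Module.End K A)[X]) ^ n
      = F at ih ⊢
    generalize ((LieAlgebra.ad K A[X] (X * C x + C y)) ^ n) (C z) = G at ih ⊢
    rw [add_mul, mul_assoc, add_mul, mul_add, mul_assoc, ← mul_assoc G, ← X_mul (p := G),
      mul_assoc X G]
    cases k with
    | zero => simp [mul_coeff_zero, -X_mul_C, ih, Ring.lie_def]
    | succ k =>
      simp only [coeff_add, coeff_sub, coeff_X_mul, coeff_C_mul, coeff_mul_C, LinearMap.add_apply,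
        Module.End.mul_apply, ih, LieAlgebra.ad_apply, Ring.lie_def]
      abel

theorem LieHom.map_coeff_ad_pow {L L' : Type*} [LieRing L] [LieAlgebra K L] [LieRing L']
    [LieAlgebra K L'] (f : L →ₗ⁅K⁆ L') (x y z : L) (n k : ℕ) :
    f ((((X * C (LieAlgebra.ad K L x) + C (LieAlgebra.ad K L y) : (Module.End K L)[X]) ^
      n).coeff k) z) =
    (((X * C (LieAlgebra.ad K L' (f x)) + C (LieAlgebra.ad K L' (f y)) :
      (Module.End K L')[X]) ^ n).coeff k) (f z) := by
  induction n generalizing k with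
  | zero => by_cases hk : k = 0 <;> simp [coeff_one, hk]
  | succ n ih =>
    rw [pow_succ', pow_succ', add_mul, add_mul, mul_assoc, mul_assoc]
    cases k with
    | zero => simp [mul_coeff_zero, -X_mul_C, ih]
    | succ k => simp [coeff_X_mul, -X_mul_C, ih]

theorem LieHom.map_restrictedCoeff {L L' : Type*} [LieRing L] [LieAlgebra K L] [LieRing L']
    [LieAlgebra K L'] (f : L →ₗ⁅K⁆ L') (p i : ℕ) (x y : L) :
    f (restrictedCoeff K p i x y) = restrictedCoeff K p i (f x) (f y) := by
  rw [restrictedCoeff, restrictedCoeff, _root_.map_smul, f.map_coeff_ad_pow]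

/-- Jacobson's formula for the `p`-th power of a sum in an associative algebra. -/
theorem add_pow_char_eq_add_sum_restrictedCoeff [CharP K p] (hp : p.Prime) (x y : A) :
    (x + y) ^ p = x ^ p + y ^ p + ∑ i ∈ Finset.Ico 1 p, restrictedCoeff K p i x y := by
  have hpp := hp.pos
  have hA : (p : A) = 0 := by
    rw [← map_natCast (algebraMap K A), CharP.cast_eq_zero, map_zero]
  have hAX : (p : A[X]) = 0 := by rw [← C_eq_natCast, hA, C_0]
  set q : A[X] := X * C x + C y with hq
  -- Differentiating `q^p` gives `∑ q^k x q^(p-1-k) = ad(q)^(p-1)(x)`. Its coefficient at `X^(i-1)`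
  -- is `i` times that of `q^p` at `X^i`, and `i` is invertible in `K`.
  have hcoeff : ∀ i ∈ Finset.Ico 1 p, (q ^ p).coeff i = restrictedCoeff K p i x y := by
    intro i hi
    rw [Finset.mem_Ico] at hi
    have hu : IsUnit (i : K) := by
      have hc : Nat.Coprime i p := (Nat.coprime_of_lt_prime (by omega) hi.2 hp).symm
      have h1 := Nat.isCoprime_iff_coprime.2 hc
      obtain ⟨a, b, hab⟩ := h1
      refine IsUnit.of_mul_eq_one (a : K) ?_
      have := congrArg (Int.cast : ℤ → K) hab
      push_cast at this
      rw [CharP.cast_eq_zero K p, mul_zero, add_zero] at this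
      rw [mul_comm, this]
    have h1 : derivative (q ^ p) = (LieAlgebra.ad K A[X] q ^ (p - 1)) (C x) := by
      rw [LieAlgebra.ad_pow_pred_char_apply hp hAX, derivative_pow_eq_sum]
      have : derivative q = C x := by simp [hq]
      rw [this]
    have h2 := congrArg (fun f => f.coeff (i - 1)) h1
    simp only [coeff_derivative] at h2
    rw [hq, ← coeff_ad_pow_apply, ← hq, Nat.sub_add_cancel hi.1, ← Nat.cast_add_one,
      Nat.sub_add_cancel hi.1] at h2
    rw [restrictedCoeff, ← h2, ← (Nat.cast_commute i _).eq, ← map_natCast (algebraMap K A),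
      ← Algebra.smul_def, smul_smul, Ring.inverse_mul_cancel _ hu, one_smul]
  have hdeg : q.natDegree ≤ 1 := by
    rw [hq]
    refine (natDegree_add_le _ _).trans (max_le ?_ (by simp))
    rw [X_mul_C]
    simpa using natDegree_C_mul_X_pow_le x 1
  have h0 : (q ^ p).coeff 0 = y ^ p := by
    rw [← constantCoeff_apply, map_pow]
    simp [hq]
  have h1 : (q ^ p).coeff p = x ^ p := by
    have := coeff_pow_of_natDegree_le (m := p) hdeg
    rw [mul_one] at this
    rw [this, hq]
    simp [coeff_C]
  -- Evaluation at `1` is multiplicative on `A[X]` although `A` is not commutative, since `1` is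
  -- central.
  have h2 : (x + y) ^ p = (eval₂RingHom' (RingHom.id A) 1 fun a => Commute.one_right a) (q ^ p) := by
    rw [map_pow]
    simp [hq, eval₂RingHom', eval₂_mul_noncomm]
  rw [h2]
  change eval₂ _ _ _ = _
  rw [eval₂_eq_sum_range' _ (n := p + 1) (Nat.lt_succ_of_le
    ((natDegree_pow_le_of_le p hdeg).trans (by omega)))]
  simp only [RingHom.id_apply, one_pow, mul_one]
  rw [Finset.sum_range_succ, h1, Finset.range_eq_Ico, Finset.sum_eq_sum_Ico_succ_bot hpp, h0,
    Finset.sum_congr rfl hcoeff]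
  abel

end CharPAlgebra

/-! ### Hochschild's formula for the `p`-th power of `r X`. -/

section Hochschild

variable {R : Type*} [CommRing R]

/-- If `X r - r X = D r`, then `(r X) ^ n = ∑ k, hochschildCoeff D r n k * X ^ k`. -/
def hochschildCoeff (D : R → R) (r : R) : ℕ → ℕ → R
  | 0, 0 => 1
  | 0, _ + 1 => 0
  | n + 1, 0 => r * D (hochschildCoeff D r n 0)
  | n + 1, k + 1 => r * D (hochschildCoeff D r n (k + 1)) + r * hochschildCoeff D r n k

theorem hochschildCoeff_succ_zero (D : R →+ R) (hD : D 1 = 0) (r : R) (n : ℕ) :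
    hochschildCoeff D r (n + 1) 0 = 0 := by
  induction n with
  | zero => simp [hochschildCoeff, hD]
  | succ n ih => rw [hochschildCoeff, ih, map_zero, mul_zero]

theorem hochschildCoeff_eq_zero_of_lt (D : R →+ R) (r : R) {n k : ℕ} (h : n < k) :
    hochschildCoeff D r n k = 0 := by
  induction n generalizing k with
  | zero => obtain ⟨k, rfl⟩ := Nat.exists_eq_succ_of_ne_zero h.ne'; rfl
  | succ n ih =>
    obtain ⟨k, rfl⟩ := Nat.exists_eq_succ_of_ne_zero (Nat.ne_zero_of_lt h)
    rw [hochschildCoeff, ih (by omega), ih (by omega), map_zero, mul_zero, add_zero]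

theorem hochschildCoeff_self (D : R →+ R) (r : R) (n : ℕ) :
    hochschildCoeff D r n n = r ^ n := by
  induction n with
  | zero => simp [hochschildCoeff]
  | succ n ih =>
    rw [hochschildCoeff, ih, hochschildCoeff_eq_zero_of_lt D r (Nat.lt_succ_self n), map_zero,
      mul_zero, zero_add, pow_succ']

theorem hochschildCoeff_succ_one (D : R →+ R) (hD : D 1 = 0) (r : R) (n : ℕ) :
    hochschildCoeff D r (n + 1) 1 = (fun s => r * D s)^[n] r := by
  induction n with
  | zero => simp [hochschildCoeff]
  | succ n ih =>
    rw [hochschildCoeff, ih, hochschildCoeff_succ_zero D hD, mul_zero, add_zero,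
      Function.iterate_succ_apply']

theorem mul_pow_eq_sum_hochschildCoeff {A : Type*} [Ring A] (f : R →+* A) (D : R →+ R)
    {Y : A} (hY : ∀ s, Y * f s = f s * Y + f (D s)) (r : R) (n : ℕ) :
    (f r * Y) ^ n = ∑ k ∈ Finset.range (n + 1), f (hochschildCoeff D r n k) * Y ^ k := by
  induction n with
  | zero => simp [hochschildCoeff]
  | succ n ih =>
    have h1 : ∀ k, (f r * Y) * (f (hochschildCoeff D r n k) * Y ^ k) =
        f (r * D (hochschildCoeff D r n k)) * Y ^ k +
          f (r * hochschildCoeff D r n k) * Y ^ (k + 1) := by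
      intro k
      rw [mul_assoc, ← mul_assoc Y, hY, map_mul, map_mul, pow_succ']
      noncomm_ring
    rw [pow_succ', ih, Finset.mul_sum, Finset.sum_congr rfl fun k _ => h1 k,
      Finset.sum_add_distrib, Finset.sum_range_succ' _ (n + 1)]
    simp only [hochschildCoeff, map_add, add_mul, Finset.sum_add_distrib]
    rw [Finset.sum_range_succ' _ n, Finset.sum_range_succ (fun k =>
      f (r * D (hochschildCoeff D r n (k + 1))) * Y ^ (k + 1)) n,
      hochschildCoeff_eq_zero_of_lt D r (Nat.lt_succ_self n)]
    simp only [map_zero, mul_zero, zero_mul]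
    abel

/-- This is `mul_pow_eq_sum_hochschildCoeff` in the additive endomorphism ring of `R`, with `Y = D`.
-/
theorem iterate_mul_eq_sum_hochschildCoeff (D : R →+ R)
    (hD : ∀ a b, D (a * b) = a * D b + D a * b) (r : R) (n : ℕ) (a : R) :
    (fun s => r * D s)^[n] a = ∑ k ∈ Finset.range (n + 1), hochschildCoeff D r n k * D^[k] a := by
  have h := mul_pow_eq_sum_hochschildCoeff (Module.toModuleEnd ℤ R) D
    (Y := D.toIntLinearMap) (fun s => by ext1 a; exact hD s a) r n
  have h := LinearMap.congr_fun h a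
  simp only [LinearMap.sum_apply, Module.End.mul_apply, Module.End.pow_apply] at h
  exact h

-- The commutator of `D` with multiplication by `a` is multiplication by `D a`. Iterating `p` times
-- gives multiplication by `D^p a`, while `ad(D)^p` is the commutator with `D^p`.
attribute [local instance] LieRing.ofAssociativeRing in
theorem AddMonoidHom.iterate_char_mul_of_leibniz {p : ℕ} (hp : p.Prime) (h : (p : R) = 0)
    (D : R →+ R) (hD : ∀ a b, D (a * b) = a * D b + D a * b) (a b : R) :
    D^[p] (a * b) = a * D^[p] b + D^[p] a * b := by
  have h1 : (p : Module.End ℤ R) = 0 := by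
    ext y
    rw [Module.End.natCast_apply, ← Nat.cast_smul_eq_nsmul R, h]; simp
  let d : Module.End ℤ R := D.toIntLinearMap
  have hd : ∀ n y, (d ^ n) y = D^[n] y := fun n y => by rw [Module.End.pow_apply]; rfl
  have h2 : ∀ n, (LieAlgebra.ad ℤ (Module.End ℤ R) d ^ n) (Module.toModuleEnd ℤ R a) =
      Module.toModuleEnd ℤ R (D^[n] a) := by
    intro n
    induction n with
    | zero => rfl
    | succ n ih =>
      rw [pow_succ', Module.End.mul_apply, ih, Function.iterate_succ_apply', LieAlgebra.ad_apply,
        Ring.lie_def]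
      ext y
      change D (D^[n] a * y) - D^[n] a * D y = D (D^[n] a) * y
      rw [hD]; ring
  have h3 := LinearMap.congr_fun (h2 p) b
  rw [LieAlgebra.ad_pow_char_apply hp h1] at h3
  change (d ^ p) (a * b) - a * (d ^ p) b = D^[p] a * b at h3
  rw [hd, hd] at h3
  rw [← h3]
  ring

/-- The coefficients are detected by a generic model: extend `D` to a derivation `E` of `R[X]` with
`E X = 1`. Then `F = r E` is a derivation, hence so is `F^p = ∑ c_k E^k`, and evaluating both
descriptions of `F^p` on `X^m` isolates `m! c_m`, where `m!` is invertible as `m < p`. -/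
theorem hochschildCoeff_char_eq_zero {p : ℕ} (hp : p.Prime) (h : (p : R) = 0)
    (D : R →+ R) (hD : ∀ a b, D (a * b) = a * D b + D a * b) (r : R) {m : ℕ} (hm : 2 ≤ m)
    (hmp : m < p) : hochschildCoeff D r p m = 0 := by
  let : Differential R := ⟨Derivation.mk' D.toIntLinearMap fun a b => by
    simp [hD, mul_comm b]⟩
  let E : R[X] →+ R[X] :=
    (Differential.implicitDeriv (1 : R[X])).toLinearMap.toAddMonoidHom
  have hEm : ∀ f g, E (f * g) = f * E g + E f * g := fun f g => by
    rw [mul_comm (E f)]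
    exact (Differential.implicitDeriv (1 : R[X])).leibniz f g
  have hE : ∀ a, E (C a) = C (D a) := fun a => Differential.implicitDeriv_C 1 a
  have hEX : E X = 1 := Differential.implicitDeriv_X 1
  have hRX : (p : R[X]) = 0 := by rw [← C_eq_natCast, h, C_0]
  have hEXm : ∀ m, E (X ^ (m + 1)) = ((m + 1 : ℕ) : R[X]) * X ^ m := by
    intro m
    induction m with
    | zero => simp [hEX]
    | succ m ih =>
      rw [pow_succ, hEm, hEX, ih]
      push_cast
      ring
  have hD1 : D 1 = 0 := by simpa using hD 1 1
  have hDn : ∀ n : ℕ, D n = 0 := fun n => by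
    rw [← nsmul_one n, map_nsmul, hD1, smul_zero]
  have hiter : ∀ k m, E^[k] (X ^ m) = C (m.descFactorial k : R) * X ^ (m - k) := by
    intro k
    induction k with
    | zero => simp
    | succ k ih =>
      intro m
      rw [Function.iterate_succ_apply', ih, hEm, hE, hDn]
      rcases Nat.lt_or_ge k m with hk | hk
      · obtain ⟨j, rfl⟩ := Nat.exists_eq_add_of_lt hk
        have e1 : k + j + 1 - k = j + 1 := by omega
        have e2 : k + j + 1 - (k + 1) = j := by omega
        rw [e1, hEXm, Nat.descFactorial_succ, e1, e2]
        simp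
        ring
      · have e1 : m - k = 0 := by omega
        have hE1 : E 1 = 0 := by rw [← C_1, hE, hD1, C_0]
        rw [Nat.descFactorial_succ, e1]
        simp [hE1]
  let F : R[X] →+ R[X] := (AddMonoidHom.mulLeft (C r)).comp E
  have hFm : ∀ f g, F (f * g) = f * F g + F f * g := fun f g => by
    change C r * E (f * g) = f * (C r * E g) + C r * E f * g
    rw [hEm]; ring
  have hF : ∀ f, F^[p] f =
      ∑ k ∈ Finset.range (p + 1), C (hochschildCoeff D r p k) * E^[k] f := by
    intro f
    have h1 : ∀ n k, hochschildCoeff E (C r) n k = C (hochschildCoeff D r n k) := by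
      intro n
      induction n with
      | zero => intro k; cases k <;> simp [hochschildCoeff]
      | succ n ih => intro k; cases k <;> simp [hochschildCoeff, ih, hE]
    have h2 := iterate_mul_eq_sum_hochschildCoeff E hEm (C r) p f
    simp only [h1] at h2
    exact h2
  obtain ⟨m, rfl⟩ := Nat.exists_eq_add_of_le' hm
  have hFXm : ∀ m, F^[p] (X ^ (m + 1)) = ((m + 1 : ℕ) : R[X]) * X ^ m * F^[p] X := by
    intro m
    induction m with
    | zero => simp
    | succ m ih =>
      rw [pow_succ, F.iterate_char_mul_of_leibniz hp hRX hFm, ih]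
      push_cast
      ring
  have hFX : F^[p] X = C (hochschildCoeff D r p 1) := by
    rw [hF, Finset.sum_eq_single 1]
    · simp [hEX]
    · intro k _ hk
      rcases k with _ | _ | k
      · obtain ⟨q, hq⟩ := Nat.exists_eq_succ_of_ne_zero hp.ne_zero
        rw [hq, hochschildCoeff_succ_zero D hD1]; simp
      · exact absurd rfl hk
      · have := hiter (k + 2) 1
        rw [pow_one] at this
        rw [this]
        simp
    · intro h; exact absurd (Finset.mem_range.2 (by have := hp.pos; omega)) h
  have h1 := hFXm (m + 1)
  rw [hFX, hF] at h1
  -- At `X = 0` only `k = m + 2` survives in `∑ c_k E^k (X^(m+2))`, with factor `(m+2)!`; the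
  -- derivation rule makes the other side divisible by `X`.
  have h2 := congrArg (fun f => coeff f 0) h1
  simp only [finsetSum_coeff, hiter, coeff_C_mul] at h2
  rw [Finset.sum_eq_single (m + 2)] at h2
  · rw [mul_comm _ (X ^ (m + 1)), mul_assoc, pow_succ', mul_assoc, coeff_X_mul_zero] at h2
    simp only [Nat.sub_self, pow_zero, coeff_one_zero, mul_one, Nat.descFactorial_self] at h2
    have hc : Nat.Coprime (m + 2).factorial p :=
      ((hp.coprime_iff_not_dvd).2 fun hd => by have := hp.dvd_factorial.1 hd; omega).symm
    obtain ⟨a, b, hab⟩ := Nat.isCoprime_iff_coprime.2 hc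
    have h3 := congrArg (Int.cast : ℤ → R) hab
    push_cast at h3
    rw [h, mul_zero, add_zero] at h3
    calc hochschildCoeff D r p (m + 2)
        = a * (hochschildCoeff D r p (m + 2) * ((m + 2).factorial : R)) := by
          rw [mul_left_comm, h3, mul_one]
      _ = 0 := by rw [h2, mul_zero]
  · intro k _ hk
    rcases Nat.lt_or_gt_of_ne hk with hk | hk
    · obtain ⟨j, hj⟩ := Nat.exists_eq_add_of_lt hk
      have : m + 2 - k = j + 1 := by omega
      rw [this, pow_succ, coeff_mul_X_zero, mul_zero, mul_zero]
    · rw [Nat.descFactorial_of_lt hk]; simp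
  · intro h; exact absurd (Finset.mem_range.2 (by omega)) h

/-- Hochschild's formula for the `p`-th power of `r X`, if `X` acts on `R` by the derivation
`D`. -/
theorem mul_pow_char_eq {p : ℕ} (hp : p.Prime) (h : (p : R) = 0) {A : Type*} [Ring A]
    (f : R →+* A) (D : R →+ R) (hD : ∀ a b, D (a * b) = a * D b + D a * b) {Y : A}
    (hY : ∀ s, Y * f s = f s * Y + f (D s)) (r : R) :
    (f r * Y) ^ p = f (r ^ p) * Y ^ p + f ((fun s => r * D s)^[p - 1] r) * Y := by
  have h2 := hp.two_le
  have hD1 : D 1 = 0 := by simpa using hD 1 1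
  rw [mul_pow_eq_sum_hochschildCoeff f D hY, Finset.sum_range_succ, hochschildCoeff_self, add_comm]
  congr 1
  rw [Finset.sum_eq_single 1]
  · rw [pow_one, ← hochschildCoeff_succ_one D hD1, Nat.sub_add_cancel hp.one_le]
  · intro k hk hk1
    have hk := Finset.mem_range.1 hk
    rcases k with _ | _ | k
    · rw [← Nat.sub_add_cancel hp.one_le, hochschildCoeff_succ_zero D hD1]; simp
    · exact absurd rfl hk1
    · rw [hochschildCoeff_char_eq_zero hp h D hD r (by omega) hk]; simp
  · intro h; exact absurd (Finset.mem_range.2 (by omega)) h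

end Hochschild

/-! ### Kaplansky's theorem: projective modules over local rings are free. -/

section Kaplansky

universe u v

variable {R : Type u} {ι : Type v} [CommRing R] [IsLocalRing R]

theorem Ideal.exists_finset_minimal_span_image {R ι : Type*} [CommRing R] (a : ι → R)
    (s : Finset ι) : ∃ t ⊆ s, (∀ k ∈ s, a k ∈ Ideal.span (a '' t)) ∧
      ∀ i ∈ t, a i ∉ Ideal.span (a '' (t \ {i} : Set ι)) := by
  classical
  have hne : (s.powerset.filter fun t : Finset ι =>
      ∀ k ∈ s, a k ∈ Ideal.span (a '' (t : Set ι))).Nonempty :=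
    ⟨s, Finset.mem_filter.2 ⟨Finset.mem_powerset_self s, fun k hk =>
      Ideal.subset_span (Set.mem_image_of_mem a hk)⟩⟩
  obtain ⟨t, ht, hmin⟩ := Finset.exists_min_image _ Finset.card hne
  rw [Finset.mem_filter, Finset.mem_powerset] at ht
  refine ⟨t, ht.1, ht.2, fun i hi hai => ?_⟩
  have h1 := hmin (t.erase i) (Finset.mem_filter.2
    ⟨Finset.mem_powerset.2 ((Finset.erase_subset _ _).trans ht.1), fun k hk => ?_⟩)
  · exact absurd h1 (not_le.2 (Finset.card_erase_lt_of_mem hi))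
  · rw [Finset.coe_erase]
    refine Submodule.span_le.2 ?_ (ht.2 k hk)
    rintro _ ⟨j, hj, rfl⟩
    by_cases hji : j = i
    · rw [hji]; exact hai
    · exact Submodule.subset_span ⟨j, ⟨hj, hji⟩, rfl⟩

/-- Over a local ring, a vector in the range of an idempotent endomorphism of a free module lies
in a finite free direct summand of this range. -/
theorem exists_finite_free_summand (π : (ι →₀ R) →ₗ[R] ι →₀ R) (hπ : ∀ z, π (π z) = π z)
    (x : ι →₀ R) (hx : π x = x) :
    ∃ (t : Finset ι) (y : (t → R) →ₗ[R] ι →₀ R) (g : (ι →₀ R) →ₗ[R] t → R),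
      g ∘ₗ y = LinearMap.id ∧ (∀ c, y c ∈ LinearMap.range π) ∧ (∃ g', g = g' ∘ₗ π) ∧
      x ∈ LinearMap.range y := by
  classical
  obtain ⟨t, -, hspan, hmin⟩ := Ideal.exists_finset_minimal_span_image x x.support
  have hb : ∀ k, ∃ b : t → R, k ∈ x.support → ∑ i : t, b i * x i = x k := by
    intro k
    by_cases hk : k ∈ x.support
    · obtain ⟨b, hb⟩ := Submodule.mem_span_image_finset_iff_exists_fun R |>.1 (hspan k hk)
      exact ⟨b, fun _ => hb⟩
    · exact ⟨0, fun h => absurd h hk⟩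
  choose b hb using hb
  -- Expressing all coordinates of `x` through those in `t` and applying `π` gives `x = ∑ x_i v_i`
  -- with every `v_i` in the range of `π`.
  let v : t → ι →₀ R := fun i => π (∑ k ∈ x.support, Finsupp.single k (b k i))
  let y : (t → R) →ₗ[R] ι →₀ R := Fintype.linearCombination R v
  have hxy : y (fun i => x i) = x := by
    conv_rhs => rw [← hx]
    simp only [y, Fintype.linearCombination_apply, v, ← map_smul, ← map_sum]
    congr 1
    simp only [Finset.smul_sum, Finsupp.smul_single, smul_eq_mul]
    rw [Finset.sum_comm]
    conv_rhs => rw [← Finsupp.sum_single x, Finsupp.sum]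
    refine Finset.sum_congr rfl fun k hk => ?_
    rw [← Finsupp.single_finsetSum, ← hb k hk]
    simp only [mul_comm]
  let g₀ : (ι →₀ R) →ₗ[R] t → R := LinearMap.pi fun j => Finsupp.lapply (j : ι)
  let C : Matrix t t R := LinearMap.toMatrix' (g₀ ∘ₗ y)
  -- The vector of coordinates `x_i`, `i ∈ t`, is fixed by `C`. A unit entry of `1 - C` would put
  -- some `x_i` in the ideal of the others, against minimality of `t`. So `C` is the identity modulo
  -- the maximal ideal, hence invertible.
  have hC : ∀ j i : t, ¬ IsUnit ((1 - C) j i) := by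
    intro j i hu
    refine hmin i i.2 ?_
    have h1 : ∑ k : t, (1 - C) j k * x k = 0 := by
      have h2 : C.mulVec (fun i : t => x i) = fun i : t => x i := by
        rw [← Matrix.toLin'_apply, Matrix.toLin'_toMatrix', LinearMap.comp_apply, hxy]
        rfl
      have h3 : (1 - C).mulVec (fun i : t => x i) = 0 := by
        rw [Matrix.sub_mulVec, h2, Matrix.one_mulVec, sub_self]
      exact congrFun h3 j
    rw [← Finset.add_sum_erase _ _ (Finset.mem_univ i)] at h1
    have h4 : (1 - C) j i * x i ∈ Ideal.span (x '' ((t : Set ι) \ {(i : ι)})) := by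
      rw [eq_neg_of_add_eq_zero_left h1]
      refine neg_mem (Ideal.sum_mem _ fun k hk => Ideal.mul_mem_left _ _
        (Submodule.subset_span ⟨k, ⟨k.2, fun h => ?_⟩, rfl⟩))
      exact (Finset.mem_erase.1 hk).1 (Subtype.ext h)
    exact (Ideal.unit_mul_mem_iff_mem _ hu).1 h4
  have hdet : IsUnit C.det := by
    rw [← IsLocalRing.residue_ne_zero_iff_isUnit, RingHom.map_det]
    have : (IsLocalRing.residue R).mapMatrix C = 1 := by
      rw [← sub_eq_zero, ← neg_eq_zero, neg_sub, ← map_one (IsLocalRing.residue R).mapMatrix,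
        ← map_sub]
      ext j i
      exact (IsLocalRing.residue_eq_zero_iff _).2 (hC j i)
    rw [this, Matrix.det_one]
    exact one_ne_zero
  have hy : ∀ c, y c = π (Fintype.linearCombination R
      (fun i : t => ∑ k ∈ x.support, Finsupp.single k (b k i)) c) := by
    intro c
    simp only [y, v, Fintype.linearCombination_apply, map_sum, map_smul]
  refine ⟨t, y, (Matrix.toLin' C⁻¹ ∘ₗ g₀) ∘ₗ π, ?_, fun c => ⟨_, (hy c).symm⟩, ⟨_, rfl⟩,
    ⟨_, hxy⟩⟩
  have h1 : π ∘ₗ y = y := LinearMap.ext fun c => by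
    rw [LinearMap.comp_apply, hy, hπ]
  rw [LinearMap.comp_assoc, h1, LinearMap.comp_assoc, ← Matrix.toLin'_toMatrix' (g₀ ∘ₗ y),
    ← Matrix.toLin'_mul, Matrix.nonsing_inv_mul _ hdet, Matrix.toLin'_one]

/-- The range of an idempotent endomorphism of a free module over a local ring is free if it is
countably generated. -/
theorem exists_basis_range_of_countable (π : (ι →₀ R) →ₗ[R] ι →₀ R)
    (hπ : ∀ z, π (π z) = π z) (x : ℕ → ι →₀ R)
    (hx : LinearMap.range π ≤ Submodule.span R (Set.range x)) :
    ∃ (κ : Type v) (v : κ → ι →₀ R), LinearIndependent R v ∧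
      Submodule.span R (Set.range v) = LinearMap.range π := by
  classical
  have key : ∀ (ρ : {ρ : (ι →₀ R) →ₗ[R] ι →₀ R // ∀ z, ρ (ρ z) = ρ z}) (z : ι →₀ R),
      ∃ (t : Finset ι) (y : (t → R) →ₗ[R] ι →₀ R) (g : (ι →₀ R) →ₗ[R] t → R),
        (∀ c, g (y c) = c) ∧ (∀ c, ρ.1 (y c) = y c) ∧ (∀ w, g (ρ.1 w) = g w) ∧
        y (g (ρ.1 z)) = ρ.1 z := by
    rintro ⟨ρ, hρ⟩ z
    obtain ⟨t, y, g, hgy, hy, ⟨g', rfl⟩, c, hc⟩ := exists_finite_free_summand ρ hρ (ρ z) (hρ z)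
    refine ⟨t, y, g' ∘ₗ ρ, fun c => LinearMap.congr_fun hgy c, fun c => ?_, fun w => ?_, ?_⟩
    · obtain ⟨w, hw⟩ := hy c
      rw [← hw, hρ]
    · simp only [LinearMap.comp_apply, hρ]
    · rw [← hc]
      exact congrArg y (LinearMap.congr_fun hgy c)
  choose t y g h1 h2 h3 h4 using key
  -- Splitting off the range of `y ρ z` leaves an idempotent that kills `z`. Applied successively to
  -- the generators `x n`, this exhausts the range of `π` by mutually orthogonal finite free
  -- summands.
  let next : {ρ : (ι →₀ R) →ₗ[R] ι →₀ R // ∀ z, ρ (ρ z) = ρ z} → (ι →₀ R) →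
      {ρ : (ι →₀ R) →ₗ[R] ι →₀ R // ∀ z, ρ (ρ z) = ρ z} := fun ρ z =>
    ⟨ρ.1 - y ρ z ∘ₗ g ρ z, fun w => by simp [ρ.2, h1, h2, h3]⟩
  let P : ℕ → {ρ : (ι →₀ R) →ₗ[R] ι →₀ R // ∀ z, ρ (ρ z) = ρ z} :=
    fun n => Nat.rec ⟨π, hπ⟩ (fun n ρ => next ρ (x n)) n
  have hPs : ∀ n w, (P (n + 1)).1 w = (P n).1 w - y (P n) (x n) (g (P n) (x n) w) :=
    fun n w => rfl
  have hPle : ∀ n k w, (P n).1 ((P (n + k)).1 w) = (P (n + k)).1 w ∧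
      (P (n + k)).1 ((P n).1 w) = (P (n + k)).1 w := by
    intro n k
    induction k with
    | zero => intro w; exact ⟨(P n).2 w, (P n).2 w⟩
    | succ k ih =>
      intro w
      rw [← add_assoc, hPs, hPs, map_sub, (ih w).1, (ih w).2, ← h2 (P (n + k)), (ih _).1,
        h2, ← h3 (P (n + k)) _ ((P n).1 w), (ih w).2, h3]
      exact ⟨rfl, rfl⟩
  have hgy : ∀ m n, m ≠ n → ∀ c, g (P m) (x m) (y (P n) (x n) c) = 0 := by
    intro m n hmn c
    rcases Nat.lt_or_gt_of_ne hmn with h | h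
    · obtain ⟨k, rfl⟩ := Nat.exists_eq_add_of_le (Nat.succ_le_of_lt h)
      rw [← h2, ← (hPle (m + 1) k _).1, hPs, map_sub, h1, (h3 (P m)), sub_self]
    · obtain ⟨k, rfl⟩ := Nat.exists_eq_add_of_le (Nat.succ_le_of_lt h)
      rw [← h3, ← (hPle (n + 1) k _).2, hPs, h1, h2, sub_self, map_zero, map_zero]
  have hyπ : ∀ n c, π (y (P n) (x n) c) = y (P n) (x n) c := by
    intro n c
    rw [← h2]
    have := (hPle 0 n (y (P n) (x n) c)).1
    rwa [zero_add] at this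
  let v : (Σ n, t (P n) (x n)) → ι →₀ R := fun i => y (P i.1) (x i.1) (Pi.single i.2 1)
  refine ⟨_, v, ?_, le_antisymm ?_ ?_⟩
  · let G : (ι →₀ R) →ₗ[R] (Σ n, t (P n) (x n)) → R :=
      LinearMap.pi fun i => LinearMap.proj i.2 ∘ₗ g (P i.1) (x i.1)
    refine LinearIndependent.of_comp G ?_
    have : (G ∘ v) = fun i => Pi.single i 1 := by
      ext ⟨n, i⟩ ⟨m, j⟩
      simp only [G, v, Function.comp_apply, LinearMap.pi_apply, LinearMap.comp_apply, LinearMap.proj_apply]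
      by_cases hmn : m = n
      · subst hmn
        rw [h1]
        by_cases hij : j = i
        · subst hij; simp
        · have : (⟨m, j⟩ : Σ n, t (P n) (x n)) ≠ ⟨m, i⟩ := fun h => hij (by simpa using h)
          rw [Pi.single_eq_of_ne hij, Pi.single_eq_of_ne this]
      · have : (⟨m, j⟩ : Σ n, t (P n) (x n)) ≠ ⟨n, i⟩ := fun h => hmn (congrArg Sigma.fst h)
        rw [hgy m n hmn, Pi.single_eq_of_ne this]; rfl
    rw [this]
    exact Pi.linearIndependent_single_one _ R
  · rw [Submodule.span_le]
    rintro _ ⟨i, rfl⟩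
    exact ⟨_, hyπ _ _⟩
  · have hyv : ∀ n c, y (P n) (x n) c ∈ Submodule.span R (Set.range v) := by
      intro n c
      rw [pi_eq_sum_univ' c, map_sum]
      refine Submodule.sum_mem _ fun i _ => ?_
      rw [map_smul]
      refine Submodule.smul_mem _ _ (Submodule.subset_span ⟨⟨n, i⟩, ?_⟩)
      simp only [v]
    have hstep : ∀ n w, π w - (P n).1 w ∈ Submodule.span R (Set.range v) := by
      intro n w
      induction n with
      | zero => simp [P]
      | succ n ih =>
        rw [hPs, ← sub_add]
        exact add_mem ih (hyv _ _)
    have hzero : ∀ n, (P (n + 1)).1 (x n) = 0 := by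
      intro n
      rw [hPs, ← h3, h4, sub_self]
    have hxv : ∀ n, π (x n) ∈ Submodule.span R (Set.range v) := by
      intro n
      have := hstep (n + 1) (x n)
      rwa [hzero, sub_zero] at this
    rintro _ ⟨w, rfl⟩
    rw [← hπ]
    have : Submodule.span R (Set.range x) ≤ (Submodule.span R (Set.range v)).comap π :=
      Submodule.span_le.2 (by rintro _ ⟨n, rfl⟩; exact hxv n)
    exact this (hx ⟨w, rfl⟩)

/-- A set of coordinates `J` stable under `π` lies in a larger stable set which contains `i` and
exceeds `J` by countably many elements. -/
theorem exists_stable_superset {R : Type u} {ι : Type v} [CommRing R] (π : (ι →₀ R) →ₗ[R] ι →₀ R) (i : ι) :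
    ∃ A : Set ι, A.Countable ∧ i ∈ A ∧
      ∀ j ∈ A, ∀ k ∈ (π (Finsupp.single j 1)).support, k ∈ A := by
  let A : ℕ → Set ι := fun n => Nat.rec {i}
    (fun _ B => ⋃ j ∈ B, ((π (Finsupp.single j 1)).support : Set ι)) n
  have hA : ∀ n, (A n).Countable := by
    intro n
    induction n with
    | zero => exact Set.countable_singleton i
    | succ n ih => exact ih.biUnion fun j _ => Finset.countable_toSet _
  refine ⟨⋃ n, A n, Set.countable_iUnion hA, Set.mem_iUnion.2 ⟨0, rfl⟩, fun j hj k hk => ?_⟩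
  obtain ⟨n, hn⟩ := Set.mem_iUnion.1 hj
  exact Set.mem_iUnion.2 ⟨n + 1, Set.mem_biUnion hn hk⟩

theorem map_mem_supported_of_stable {R : Type u} {ι : Type v} [CommRing R]
    (π : (ι →₀ R) →ₗ[R] ι →₀ R) {J : Set ι}
    (hJ : ∀ j ∈ J, ∀ k ∈ (π (Finsupp.single j 1)).support, k ∈ J) {w : ι →₀ R}
    (hw : w ∈ Finsupp.supported R R J) : π w ∈ Finsupp.supported R R J := by
  rw [Finsupp.supported_eq_span_single] at hw
  refine Submodule.span_le (p := (Finsupp.supported R R J).comap π) |>.2 ?_ hw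
  rintro _ ⟨j, hj, rfl⟩
  exact fun k hk => hJ j hj k hk

/-- Kaplansky's theorem for the range of an idempotent endomorphism of a free module. -/
theorem exists_basis_range_of_idempotent (π : (ι →₀ R) →ₗ[R] ι →₀ R)
    (hπ : ∀ z, π (π z) = π z) :
    ∃ B : Set (ι →₀ R), LinearIndepOn R id B ∧ Submodule.span R B = LinearMap.range π := by
  classical
  -- Zorn's lemma is applied to `π`-stable coordinate sets together with a basis of the image of
  -- their span; remembering the basis makes the chosen bases extend one another.
  let Z : Set (Set ι × Set (ι →₀ R)) := {z |
    (∀ j ∈ z.1, ∀ k ∈ (π (Finsupp.single j 1)).support, k ∈ z.1) ∧ LinearIndepOn R id z.2 ∧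
      Submodule.span R z.2 = (Finsupp.supported R R z.1).map π}
  obtain ⟨⟨J, B⟩, hmax⟩ : ∃ m, Maximal (· ∈ Z) m := by
    refine zorn_le₀ Z fun c hcZ hc => ?_
    have hdir : DirectedOn (· ≤ ·) c := hc.directedOn
    refine ⟨(⋃ z ∈ c, z.1, ⋃ z ∈ c, z.2), ⟨?_, ?_, ?_⟩, fun z hz =>
      ⟨Set.subset_biUnion_of_mem (u := Prod.fst) hz, Set.subset_biUnion_of_mem (u := Prod.snd) hz⟩⟩
    · intro j hj k hk
      obtain ⟨z, hz, hjz⟩ := Set.mem_iUnion₂.1 hj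
      exact Set.mem_iUnion₂.2 ⟨z, hz, (hcZ hz).1 j hjz k hk⟩
    · refine linearIndepOn_biUnion_of_directed ?_ fun z hz => (hcZ hz).2.1
      intro a ha b hb
      obtain ⟨d, hd, had, hbd⟩ := hdir a ha b hb
      exact ⟨d, hd, had.2, hbd.2⟩
    · simp only [Finsupp.supported_eq_span_single, Set.image_iUnion, Submodule.span_iUnion₂,
        Submodule.map_iSup]
      refine iSup_congr fun z => iSup_congr fun hz => ?_
      rw [(hcZ hz).2.2, Finsupp.supported_eq_span_single, Submodule.map_span]
  obtain ⟨hJ, hB, hspan⟩ := hmax.prop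
  have hJtop : J = Set.univ := by
    rw [Set.eq_univ_iff_forall]
    intro i
    obtain ⟨A, hAc, hiA, hA⟩ := exists_stable_superset π i
    let J' := J ∪ A
    have hJ' : ∀ j ∈ J', ∀ k ∈ (π (Finsupp.single j 1)).support, k ∈ J' := by
      rintro j (hj | hj) k hk
      · exact Or.inl (hJ j hj k hk)
      · exact Or.inr (hA j hj k hk)
    let D := J' \ J
    have hDJ' : Finsupp.supported R R D ≤ Finsupp.supported R R J' :=
      Finsupp.supported_mono Set.sdiff_subset
    have hπJ : ∀ w ∈ Finsupp.supported R R J, π w ∈ Finsupp.supported R R J := fun w =>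
      map_mem_supported_of_stable π hJ
    have hπJ' : ∀ w ∈ Finsupp.supported R R J', π w ∈ Finsupp.supported R R J' := fun w =>
      map_mem_supported_of_stable π hJ'
    let ρ : (ι →₀ R) →ₗ[R] ι →₀ R :=
      (Finsupp.supported R R D).subtype ∘ₗ Finsupp.restrictDom R R D
    have hρ : ∀ w, ρ w = Finsupp.filter (· ∈ D) w := fun w => rfl
    have hρD : ∀ w, ρ w ∈ Finsupp.supported R R D := fun w => (Finsupp.restrictDom R R D w).2
    have hρid : ∀ w ∈ Finsupp.supported R R D, ρ w = w := fun w hw => by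
      rw [hρ, Finsupp.filter_eq_self_iff]
      exact fun k hk => hw (Finsupp.mem_support_iff.2 hk)
    have hρ0 : ∀ w ∈ Finsupp.supported R R J, ρ w = 0 := fun w hw => by
      rw [hρ, Finsupp.filter_eq_zero_iff]
      intro k hk
      by_contra h0
      exact hk.2 (hw (Finsupp.mem_support_iff.2 h0))
    have hρJ : ∀ w ∈ Finsupp.supported R R J', ρ w = 0 → w ∈ Finsupp.supported R R J := by
      intro w hw h0 k hk
      rw [hρ, Finsupp.filter_eq_zero_iff] at h0
      by_contra hkJ
      exact (Finsupp.mem_support_iff.1 hk) (h0 k ⟨hw hk, hkJ⟩)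
    have hρπ : ∀ w ∈ Finsupp.supported R R J', ρ (π w) = ρ (π (ρ w)) := by
      intro w hw
      rw [← sub_eq_zero, ← map_sub, ← map_sub]
      refine hρ0 _ (hπJ _ (hρJ _ (sub_mem hw (hDJ' (hρD w))) ?_))
      rw [map_sub, hρid _ (hρD w), sub_self]
    -- As `J` and `J'` are stable, `π` acts on vectors supported on `J'` modulo those supported on
    -- `J`. Identifying this quotient with vectors supported on `D` yields `π'`, whose range is
    -- countably generated because `D ⊆ A`.
    let π' : (ι →₀ R) →ₗ[R] ι →₀ R := ρ ∘ₗ π ∘ₗ ρ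
    have hπ'a : ∀ w, π' w = ρ (π (ρ w)) := fun w => rfl
    have hπ' : ∀ w, π' (π' w) = π' w := by
      intro w
      rw [hπ'a, hπ'a, hρid _ (hρD _), ← hρπ _ (hπJ' _ (hDJ' (hρD w))), hπ]
    obtain ⟨f, hf⟩ := hAc.exists_eq_range ⟨i, hiA⟩
    obtain ⟨κ, v, hv, hvspan⟩ := exists_basis_range_of_countable π' hπ'
      (fun n => π' (Finsupp.single (f n) 1)) (by
        rintro _ ⟨w, rfl⟩
        have h1 : π' w = π' (ρ w) := by rw [hπ'a, hπ'a, hρid _ (hρD w)]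
        rw [h1]
        have h2 := hρD w
        rw [Finsupp.supported_eq_span_single] at h2
        refine Submodule.span_le (p := (Submodule.span R (Set.range fun n =>
          π' (Finsupp.single (f n) 1))).comap π') |>.2 ?_ h2
        rintro _ ⟨j, hj, rfl⟩
        have hjA : j ∈ Set.range f := by
          rw [← hf]
          exact hj.1.resolve_left hj.2
        obtain ⟨n, rfl⟩ := hjA
        exact Submodule.subset_span ⟨n, rfl⟩)
    have hvr : ∀ k, v k ∈ LinearMap.range π' := fun k =>
      hvspan ▸ Submodule.subset_span ⟨k, rfl⟩
    have hvD : ∀ k, v k ∈ Finsupp.supported R R D := fun k => by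
      obtain ⟨w, hw⟩ := hvr k
      rw [← hw]
      exact hρD _
    have hρv : ∀ k, ρ (π (v k)) = v k := fun k => by
      obtain ⟨w, hw⟩ := hvr k
      conv_lhs => rw [← hρid _ (hvD k)]
      rw [← hπ'a, ← hw, hπ']
    -- The lifts `π (v k)` stay independent after applying `ρ`, which kills everything supported on
    -- `J`; so they extend `B` to a basis for `J'`.
    have hρz : ρ ∘ (fun k => π (v k)) = v := funext hρv
    have hz : LinearIndependent R fun k => π (v k) :=
      LinearIndependent.of_comp ρ (by rw [hρz]; exact hv)
    have hmem : (J', B ∪ Set.range fun k => π (v k)) ∈ Z := by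
      refine ⟨hJ', hB.id_union hz.linearIndepOn_id ?_, ?_⟩
      · rw [hspan, Submodule.disjoint_def]
        rintro _ ⟨w, hw, rfl⟩ hu
        obtain ⟨c, hc⟩ := Finsupp.mem_span_range_iff_exists_finsupp.1 hu
        have h0 : ρ (π w) = 0 := hρ0 _ (hπJ w hw)
        rw [← hc, Finsupp.sum, map_sum] at h0
        simp only [map_smul, hρv] at h0
        have h1 := (linearIndependent_iff.1 hv) c h0
        rw [← hc, h1, Finsupp.sum_zero_index]
      · have hzJ' : Submodule.span R (Set.range fun k => π (v k)) ≤
            (Finsupp.supported R R J').map π := by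
          rw [Submodule.span_le]
          rintro _ ⟨k, rfl⟩
          exact ⟨v k, hDJ' (hvD k), rfl⟩
        rw [Submodule.span_union, hspan]
        refine le_antisymm (sup_le (Submodule.map_mono
          (Finsupp.supported_mono Set.subset_union_left)) hzJ') ?_
        rintro _ ⟨w, hw, rfl⟩
        have h1 : π' w ∈ Submodule.span R (Set.range v) := hvspan ▸ ⟨w, rfl⟩
        obtain ⟨c, hc⟩ := Finsupp.mem_span_range_iff_exists_finsupp.1 h1
        set q := c.sum fun k a => a • π (v k) with hq
        have hqz : q ∈ Submodule.span R (Set.range fun k => π (v k)) :=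
          Finsupp.mem_span_range_iff_exists_finsupp.2 ⟨c, rfl⟩
        have hρq : ρ q = ρ (π w) := by
          rw [hρπ w hw, ← hπ'a, ← hc, hq, Finsupp.sum, map_sum]
          simp only [map_smul, hρv]
          rfl
        obtain ⟨w', hw', hqw'⟩ := hzJ' hqz
        have hu : π w - q ∈ Finsupp.supported R R J := by
          refine hρJ _ (sub_mem (hπJ' w hw) ?_) (by rw [map_sub, hρq, sub_self])
          rw [← hqw']
          exact hπJ' w' hw'
        have hπu : π (π w - q) = π w - q := by
          rw [map_sub, hπ, ← hqw', hπ]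
        rw [← sub_add_cancel (π w) q]
        exact Submodule.add_mem_sup ⟨_, hu, hπu⟩ hqz
    have := hmax.le_of_ge hmem ⟨Set.subset_union_left, Set.subset_union_left⟩
    exact this.1 (Or.inr hiA)
  refine ⟨B, hB, ?_⟩
  rw [hspan, hJtop, Finsupp.supported_univ, Submodule.map_top]

/-- Kaplansky's theorem: a projective module over a local ring is free. -/
theorem Module.free_of_projective_of_isLocalRing {R M : Type*} [CommRing R] [IsLocalRing R]
    [AddCommGroup M] [Module R M] [Module.Projective R M] : Module.Free R M := by
  obtain ⟨s, hs⟩ := Module.projective_def'.1 ‹Module.Projective R M›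
  let e : (M →₀ R) →ₗ[R] M := Finsupp.linearCombination R id
  have hes : ∀ m, e (s m) = m := LinearMap.congr_fun hs
  let π := s ∘ₗ e
  obtain ⟨B, hB, hspan⟩ := exists_basis_range_of_idempotent π fun z => by
    simp only [π, LinearMap.comp_apply, hes]
  have hr : LinearMap.range π = LinearMap.range s :=
    LinearMap.range_comp_of_range_eq_top s (LinearMap.range_eq_top.2 fun m => ⟨s m, hes m⟩)
  have hfree : Module.Free R (Submodule.span R (Set.range ((↑) : B → M →₀ R))) :=
    Module.Free.of_basis (Module.Basis.span hB)
  rw [Subtype.range_coe, hspan, hr] at hfree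
  exact Module.Free.of_equiv (LinearEquiv.ofInjective s (Function.LeftInverse.injective hes)).symm

end Kaplansky

/-! ### A well-founded order on words and the linear diamond lemma. -/

namespace Word

variable {I : Type*} [LinearOrder I]

/-- The number of inversions of a word. -/
def inv : List I → ℕ
  | [] => 0
  | i :: w => w.countP (· < i) + inv w

/-- A word is less than another one if it is shorter, or if it is a permutation with fewer
inversions. -/
def LT (v w : List I) : Prop :=
  v.length < w.length ∨ v.Perm w ∧ inv v < inv w

theorem LT.length_le {v w : List I} (h : LT v w) : v.length ≤ w.length :=
  h.elim le_of_lt fun h => h.1.length_eq.le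

theorem LT.trans {u v w : List I} (h : LT u v) (h' : LT v w) : LT u w := by
  rcases h with h | h
  · exact Or.inl (h.trans_le h'.length_le)
  · rcases h' with h' | h'
    · exact Or.inl (h.1.length_eq ▸ h')
    · exact Or.inr ⟨h.1.trans h'.1, h.2.trans h'.2⟩

theorem wellFounded_LT : WellFounded (LT (I := I)) := by
  refine Subrelation.wf (r := InvImage (Prod.Lex (· < ·) (· < ·)) fun w : List I =>
    (w.length, inv w)) ?_ (InvImage.wf _ (Prod.lex Nat.lt_wfRel Nat.lt_wfRel).wf)
  rintro v w (h | h)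
  · exact Prod.Lex.left _ _ h
  · have := Prod.Lex.right (ra := (· < ·)) (rb := (· < ·)) v.length h.2
    simp only [InvImage]
    convert this using 2
    exact h.1.length_eq.symm

theorem LT.cons {v w : List I} (h : LT v w) (i : I) : LT (i :: v) (i :: w) := by
  rcases h with h | h
  · exact Or.inl (by simpa using h)
  · refine Or.inr ⟨h.1.cons i, ?_⟩
    rw [inv, inv, h.1.countP_eq]
    exact Nat.add_lt_add_left h.2 _

theorem LT.append_left {v w : List I} (h : LT v w) (u : List I) : LT (u ++ v) (u ++ w) := by
  induction u with
  | nil => exact h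
  | cons i u ih => exact ih.cons i

theorem LT_swap {i j : I} (h : j < i) (w : List I) : LT (j :: i :: w) (i :: j :: w) := by
  refine Or.inr ⟨List.Perm.swap i j w, ?_⟩
  simp only [inv, List.countP_cons, h, not_lt_of_gt h]
  simp
  omega

theorem LT_replicate_cons {i j : I} (h : j < i) {n : ℕ} (hn : n ≠ 0) (w : List I) :
    LT (List.replicate n j ++ i :: w) (i :: (List.replicate n j ++ w)) := by
  induction n with
  | zero => exact absurd rfl hn
  | succ n ih =>
    have h1 : LT (j :: i :: (List.replicate n j ++ w)) (i :: j :: (List.replicate n j ++ w)) :=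
      LT_swap h _
    rcases Nat.eq_zero_or_pos n with rfl | hn
    · exact h1
    · exact ((ih hn.ne').cons j).trans h1

theorem LT_cons_replicate {i j : I} (h : j < i) {n : ℕ} (hn : n ≠ 0) (w : List I) :
    LT (j :: (List.replicate n i ++ w)) (List.replicate n i ++ j :: w) := by
  induction n with
  | zero => exact absurd rfl hn
  | succ n ih =>
    have h1 : LT (j :: i :: (List.replicate n i ++ w)) (i :: j :: (List.replicate n i ++ w)) :=
      LT_swap h _
    rcases Nat.eq_zero_or_pos n with rfl | hn
    · exact h1
    · exact h1.trans ((ih hn.ne').cons i)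

end Word

/-- A linear form of Bergman's diamond lemma: given, for each index `w`, a set `rel w` of vectors
with leading term `w`, such that any two elements of `rel w` agree modulo the relations with smaller
leading terms, there is a linear map killing all relations and fixing the irreducible basis
vectors. -/
theorem exists_normalForm {S W : Type*} [CommRing S] (r : W → W → Prop) (hr : WellFounded r)
    (rel : W → Set (W →₀ S))
    (hlead : ∀ w, ∀ g ∈ rel w, Finsupp.single w 1 - g ∈
      Submodule.span S ((fun v => Finsupp.single v 1) '' {v | r v w}))
    (hconf : ∀ w, ∀ g ∈ rel w, ∀ g' ∈ rel w, g - g' ∈ Submodule.span S (⋃ v, ⋃ (_ : r v w), rel v)) :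
    ∃ N : (W →₀ S) →ₗ[S] W →₀ S, (∀ w, ∀ g ∈ rel w, N g = 0) ∧
      ∀ w, rel w = ∅ → N (Finsupp.single w 1) = Finsupp.single w 1 := by
  classical
  -- Each reducible `w` is rewritten by one chosen relation, then recursively. The value `0` for `v`
  -- not below `w` never occurs, by `hlead`.
  let N₀ : W → W →₀ S := hr.fix fun w IH =>
    if h : (rel w).Nonempty then
      (Finsupp.single w 1 - h.some).sum fun v c => if hv : r v w then c • IH v hv else 0
    else Finsupp.single w 1
  let N : (W →₀ S) →ₗ[S] W →₀ S := Finsupp.linearCombination S N₀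
  have hN : ∀ w, N (Finsupp.single w 1) = N₀ w := fun w => by simp [N]
  have hirr : ∀ w, rel w = ∅ → N (Finsupp.single w 1) = Finsupp.single w 1 := by
    intro w hw
    have h : ¬ (rel w).Nonempty := by rw [hw]; exact Set.not_nonempty_empty
    rw [hN]
    simp only [N₀]
    rw [hr.fix_eq, dif_neg h]
  have hred : ∀ w (h : (rel w).Nonempty), N (Finsupp.single w 1) =
      N (Finsupp.single w 1 - h.some) := by
    intro w h
    rw [hN]
    conv_lhs => simp only [N₀]
    rw [hr.fix_eq, dif_pos h, Finsupp.linearCombination_apply]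
    refine Finset.sum_congr rfl fun v hv => ?_
    have hvw : r v w := by
      have h1 := hlead w _ h.some_mem
      rw [← Finsupp.supported_eq_span_single] at h1
      exact h1 hv
    exact dif_pos hvw
  refine ⟨N, fun w => ?_, hirr⟩
  induction w using hr.induction with
  | _ w ih =>
    intro g hg
    have hne : (rel w).Nonempty := ⟨g, hg⟩
    have h1 : N hne.some = 0 := by
      have := hred w hne
      rw [map_sub] at this
      exact sub_eq_self.1 this.symm
    have h2 : Submodule.span S (⋃ v, ⋃ (_ : r v w), rel v) ≤ LinearMap.ker N := by
      rw [Submodule.span_le]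
      intro f hf
      simp only [Set.mem_iUnion] at hf
      obtain ⟨v, hv, hf⟩ := hf
      exact ih v hv f hf
    have h3 : N (g - hne.some) = 0 := h2 (hconf w g hg _ hne.some_mem)
    rwa [map_sub, h1, sub_zero] at h3

section LeibnizPower

-- On the image of `f`, `ad Y` acts as `D`; and `ad(Y)^p` is the commutator with `Y^p`.
attribute [local instance] LieRing.ofAssociativeRing in
theorem pow_char_mul_eq_of_leibniz {S A : Type*} [Semiring S] [Ring A] {p : ℕ} (hp : p.Prime)
    (h : (p : A) = 0) (f : S → A) (D : S → S) {Y : A}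
    (hY : ∀ s, Y * f s = f s * Y + f (D s)) (s : S) :
    Y ^ p * f s = f s * Y ^ p + f (D^[p] s) := by
  have h1 : ∀ n, (LieAlgebra.ad ℤ A Y ^ n) (f s) = f (D^[n] s) := by
    intro n
    induction n with
    | zero => rfl
    | succ n ih =>
      rw [pow_succ', Module.End.mul_apply, ih, Function.iterate_succ_apply', LieAlgebra.ad_apply,
        Ring.lie_def, hY, add_sub_cancel_left]
  rw [← h1, LieAlgebra.ad_pow_char_apply hp h]
  abel

theorem natCast_end_eq_zero (K : Type*) [CommRing K] (p : ℕ) [CharP K p] (M : Type*)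
    [AddCommGroup M] [Module K M] : (p : Module.End K M) = 0 := by
  have : (p : Module.End K M) = algebraMap K _ (p : K) := (map_natCast _ _).symm
  rw [this, CharP.cast_eq_zero, map_zero]

end LeibnizPower

/-! ### Operators of `L` on words and their defects. -/

/-- The data needed to construct a basis of `S ⊗[R] u(R, L)`: a family `x` in `L` which becomes
a basis after extension of scalars to `S`, the coordinate map `coord` with respect to this basis,
and an extension `der` of the anchor to derivations of `S`. -/
structure PBWDatum (p : ℕ) (K R L S I : Type*) [CommRing K] [CommRing R] [Algebra K R] [LieRing L]
    [LieAlgebra K L] [Module R L] [LieRingModule L R] [RestrictedLieAlgebra p K L] [CommRing S]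
    [Algebra R S] [Algebra K S] [IsScalarTower K R S] where
  x : I → L
  coord : L →ₗ[R] I →₀ S
  coord_x : ∀ i, coord (x i) = Finsupp.single i 1
  exists_smul_mem_span : ∀ y : L, ∃ m : R, IsUnit (algebraMap R S m) ∧
    m • y ∈ Submodule.span R (Set.range x)
  der : L →ₗ[R] Derivation K S S
  der_algebraMap : ∀ y r, der y (algebraMap R S r) = algebraMap R S ⁅y, r⁆
  der_lie : ∀ y z, der ⁅y, z⁆ = ⁅der y, der z⁆
  der_pMap : ∀ i s, der (RestrictedLieAlgebra.pMap p K (x i)) s = (der (x i))^[p] s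

namespace PBWDatum

variable {p : ℕ} {K R L S I : Type*} [CommRing K] [CommRing R] [Algebra K R] [LieRing L]
  [LieAlgebra K L] [Module R L] [LieRingModule L R] [RestrictedLieAlgebra p K L] [CommRing S]
  [Algebra R S] [Algebra K S] [IsScalarTower K R S] (d : PBWDatum p K R L S I)

/-- Up to scalars invertible in `S`, the `x i` span `L`. Hence statements `R`-linear in `y` with
values modulo an `S`-submodule need checking only at the `x i`. -/
theorem mem_of_forall_mem {M : Type*} [AddCommGroup M] [Module S M] [Module R M]
    [IsScalarTower R S M] (N : Submodule S M) (F : L →ₗ[R] M)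
    (h : ∀ i, F (d.x i) ∈ N) (y : L) : F y ∈ N := by
  obtain ⟨m, hm, hy⟩ := d.exists_smul_mem_span y
  have h1 : Submodule.span R (Set.range d.x) ≤ (N.restrictScalars R).comap F :=
    Submodule.span_le.2 (by rintro _ ⟨i, rfl⟩; exact h i)
  have h2 : F (m • y) ∈ N := h1 hy
  rw [map_smul, ← algebraMap_smul S m] at h2
  exact (Submodule.smul_mem_iff_of_isUnit N hm).1 h2

/-- The operator of `y ∈ L` on the free `S`-module on words in `I`. -/
noncomputable def op : L →ₗ[R] Module.End K (List I →₀ S) where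
  toFun y := (Finsupp.linearCombination S fun w => (d.coord y).mapDomain (· :: w)).restrictScalars K
    + Finsupp.mapRange.linearMap (d.der y : S →ₗ[K] S)
  map_add' y z := by
    ext w : 2
    simp [Finsupp.mapDomain_add, Finsupp.single_add]
    abel
  map_smul' r y := by
    ext w : 2
    simp [Finsupp.mapDomain_smul, smul_comm r]

theorem op_single (y : L) (w : List I) (s : S) :
    d.op y (Finsupp.single w s) =
      s • (d.coord y).mapDomain (· :: w) + Finsupp.single w (d.der y s) := by
  simp [op]

theorem op_x_single (i : I) (w : List I) :
    d.op (d.x i) (Finsupp.single w 1) = Finsupp.single (i :: w) 1 := by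
  simp [op_single, coord_x]

theorem op_smul (y : L) (s : S) (t : List I →₀ S) :
    d.op y (s • t) = s • d.op y t + d.der y s • t := by
  induction t using Finsupp.induction_linear with
  | zero => simp
  | add t t' ht ht' => simp only [smul_add, map_add, ht, ht']; abel
  | single w a =>
    rw [Finsupp.smul_single, op_single, op_single, smul_eq_mul, Derivation.leibniz,
      Finsupp.single_add, smul_add, mul_smul, Finsupp.smul_single, Finsupp.smul_single,
      smul_eq_mul, smul_eq_mul, mul_comm a, add_assoc]
    rfl

/-- The operator of a word. -/
noncomputable def wordOp (a : List I) : Module.End K (List I →₀ S) :=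
  (a.map fun i => d.op (d.x i)).prod

@[simp]
theorem wordOp_nil : d.wordOp [] = 1 := rfl

theorem wordOp_cons (i : I) (a : List I) : d.wordOp (i :: a) = d.op (d.x i) * d.wordOp a := by
  simp [wordOp]

theorem wordOp_append (a b : List I) : d.wordOp (a ++ b) = d.wordOp a * d.wordOp b := by
  simp [wordOp]

theorem wordOp_replicate (n : ℕ) (i : I) : d.wordOp (List.replicate n i) = d.op (d.x i) ^ n := by
  simp [wordOp]

theorem wordOp_single (a b : List I) :
    d.wordOp a (Finsupp.single b 1) = Finsupp.single (a ++ b) 1 := by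
  induction a with
  | nil => rfl
  | cons i a ih => rw [wordOp_cons, Module.End.mul_apply, ih, op_x_single]; rfl

/-- The defect of `op` to be compatible with Lie brackets. -/
noncomputable def lieDefect (y z : L) : (List I →₀ S) →ₗ[S] List I →₀ S where
  toFun t := d.op y (d.op z t) - d.op z (d.op y t) - d.op ⁅y, z⁆ t
  map_add' t t' := by simp only [map_add]; abel
  -- The first-order terms cancel because `der` respects brackets; thus the defect is `S`-linear
  -- although `op` is only `K`-linear.
  map_smul' s t := by
    simp only [op_smul, map_add, der_lie, Derivation.commutator_apply, RingHom.id_apply, smul_sub,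
      sub_smul]
    abel

theorem lieDefect_apply (y z : L) (t : List I →₀ S) : d.lieDefect y z t =
    d.op y (d.op z t) - d.op z (d.op y t) - d.op ⁅y, z⁆ t := rfl

theorem lieDefect_swap (y z : L) : d.lieDefect y z = - d.lieDefect z y := by
  refine LinearMap.ext fun t => ?_
  rw [LinearMap.neg_apply, lieDefect_apply, lieDefect_apply, ← lie_skew z y, map_neg,
    LinearMap.neg_apply]
  abel

theorem lieDefect_add_left (y y' z : L) :
    d.lieDefect (y + y') z = d.lieDefect y z + d.lieDefect y' z := by
  refine LinearMap.ext fun t => ?_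
  simp only [lieDefect_apply, LinearMap.add_apply, map_add, add_lie]
  abel

/-- The anchor term of `⁅r • y, z⁆` cancels the one created when `op z` passes the scalar `r`. -/
theorem lieDefect_smul_left [LieRinehartRing R L] (r : R) (y z : L) :
    d.lieDefect (r • y) z = r • d.lieDefect y z := by
  refine LinearMap.ext fun t => ?_
  have h : ⁅r • y, z⁆ = r • ⁅y, z⁆ - ⁅z, r⁆ • y := by
    rw [← lie_skew, LieRinehartRing.leibniz_smul_right, neg_add, ← smul_neg, lie_skew,
      ← sub_eq_add_neg]
  have h2 : d.op z (r • d.op y t) = r • d.op z (d.op y t) + ⁅z, r⁆ • d.op y t := by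
    rw [← algebraMap_smul S r, op_smul, der_algebraMap, algebraMap_smul, algebraMap_smul]
  rw [LinearMap.smul_apply, lieDefect_apply, lieDefect_apply, h]
  simp only [map_sub, map_smul, LinearMap.sub_apply, LinearMap.smul_apply, h2, smul_sub]
  abel

/-- `lieDefect` is linear in the first argument. -/
noncomputable def lieDefectLinear [LieRinehartRing R L] (z : L) (t : List I →₀ S) :
    L →ₗ[R] List I →₀ S where
  toFun y := d.lieDefect y z t
  map_add' y y' := by rw [lieDefect_add_left, LinearMap.add_apply]
  map_smul' r y := by rw [lieDefect_smul_left, LinearMap.smul_apply, RingHom.id_apply]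

theorem lieDefect_mem_of_forall_mem [LieRinehartRing R L] (N : Submodule S (List I →₀ S))
    (t : List I →₀ S) (h : ∀ i j, d.lieDefect (d.x i) (d.x j) t ∈ N) (y z : L) :
    d.lieDefect y z t ∈ N := by
  refine d.mem_of_forall_mem N (d.lieDefectLinear z t) (fun i => ?_) y
  change d.lieDefect (d.x i) z t ∈ N
  rw [lieDefect_swap, LinearMap.neg_apply, neg_mem_iff]
  refine d.mem_of_forall_mem N (d.lieDefectLinear (d.x i) t) (fun j => h j i) z

/-- The Jacobi identity for the defects. -/
theorem lieDefect_jacobi (x y z : L) (t : List I →₀ S) :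
    d.lieDefect x y (d.op z t) - d.op x (d.lieDefect y z t) =
      d.op z (d.lieDefect x y t) - d.op y (d.lieDefect x z t) - d.lieDefect y z (d.op x t) +
        d.lieDefect x z (d.op y t) - d.lieDefect ⁅x, y⁆ z t - d.lieDefect ⁅y, z⁆ x t
        + d.lieDefect ⁅x, z⁆ y t := by
  have h : d.op ⁅⁅x, y⁆, z⁆ t + d.op ⁅⁅y, z⁆, x⁆ t - d.op ⁅⁅x, z⁆, y⁆ t = 0 := by
    have : ⁅⁅x, y⁆, z⁆ + ⁅⁅y, z⁆, x⁆ - ⁅⁅x, z⁆, y⁆ = 0 := by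
      have h0 := lie_jacobi x y z
      rw [← lie_skew x ⁅y, z⁆, ← lie_skew y ⁅z, x⁆, ← lie_skew z ⁅x, y⁆, ← lie_skew z x, neg_lie,
        neg_neg] at h0
      rw [← neg_eq_zero, ← h0]
      abel
    have h1 := congrArg (fun v => d.op v t) this
    simpa only [map_add, map_sub, map_zero, LinearMap.add_apply, LinearMap.sub_apply,
      LinearMap.zero_apply] using h1
  rw [← sub_eq_zero, ← neg_eq_zero, ← h]
  simp only [lieDefect_apply, map_sub]
  abel

variable [CharP K p]

theorem op_pow_smul (hp : p.Prime) (i : I) (s : S) (t : List I →₀ S) :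
    (d.op (d.x i) ^ p) (s • t) = s • (d.op (d.x i) ^ p) t + (d.der (d.x i))^[p] s • t := by
  have h := pow_char_mul_eq_of_leibniz hp (natCast_end_eq_zero K p (List I →₀ S))
    (Module.toModuleEnd K (List I →₀ S)) (d.der (d.x i)) (Y := d.op (d.x i)) (fun s => by
      refine LinearMap.ext fun t => ?_
      rw [Module.End.mul_apply, LinearMap.add_apply, Module.End.mul_apply]
      exact d.op_smul _ s t) s
  have h1 := LinearMap.congr_fun h t
  rw [Module.End.mul_apply, LinearMap.add_apply, Module.End.mul_apply] at h1
  exact h1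

/-- The defect of `op` to be compatible with the `p`-operation at the basis element `i`. -/
noncomputable def powDefect (hp : p.Prime) (i : I) : (List I →₀ S) →ₗ[S] List I →₀ S where
  toFun t := (d.op (d.x i) ^ p) t - d.op (RestrictedLieAlgebra.pMap p K (d.x i)) t
  map_add' t t' := by simp only [map_add]; abel
  map_smul' s t := by
    rw [d.op_pow_smul hp, op_smul, der_pMap, RingHom.id_apply, smul_sub]
    abel

theorem powDefect_apply (hp : p.Prime) (i : I) (t : List I →₀ S) : d.powDefect hp i t =
    (d.op (d.x i) ^ p) t - d.op (RestrictedLieAlgebra.pMap p K (d.x i)) t := rfl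

end PBWDatum

/-! ### Rewriting relations and their leading words. -/

namespace PBWDatum

variable {p : ℕ} {K R L S I : Type*} [CommRing K] [CommRing R] [Algebra K R] [LieRing L]
  [LieAlgebra K L] [Module R L] [LieRingModule L R] [RestrictedLieAlgebra p K L] [CommRing S]
  [Algebra R S] [Algebra K S] [IsScalarTower K R S] (d : PBWDatum p K R L S I)
  [LinearOrder I] [CharP K p] (hp : p.Prime)

/-- The words which can be rewritten, with the operators describing the relations. -/
inductive IsRedex : List I → ((List I →₀ S) →ₗ[S] List I →₀ S) → Prop
  | lie (i j : I) (h : j < i) : IsRedex [i, j] (d.lieDefect (d.x i) (d.x j))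
  | pow (i : I) : IsRedex (List.replicate p i) (d.powDefect hp i)

/-- The relations with leading word `w`. -/
def rel (w : List I) : Set (List I →₀ S) :=
  {g | ∃ a u E b, d.IsRedex hp u E ∧ w = a ++ (u ++ b) ∧
    g = d.wordOp a (E (Finsupp.single b 1))}

/-- The span of the relations with leading word in `A`. -/
noncomputable def relSpan (A : Set (List I)) : Submodule S (List I →₀ S) :=
  Submodule.span S (⋃ v, ⋃ (_ : v ∈ A), d.rel hp v)

variable {d hp}

theorem mem_relSpan {A : Set (List I)} {v : List I} {g : List I →₀ S} (hg : g ∈ d.rel hp v)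
    (hv : v ∈ A) : g ∈ d.relSpan hp A :=
  Submodule.subset_span (Set.mem_iUnion₂.2 ⟨v, hv, hg⟩)

theorem relSpan_mono {A B : Set (List I)} (h : A ⊆ B) : d.relSpan hp A ≤ d.relSpan hp B :=
  Submodule.span_mono (Set.biUnion_subset_biUnion_left h)

/-- `F` is not `S`-linear: `F (s • g)` also produces a multiple of `g`. The induction therefore
carries `g ∈ N` along with `F g ∈ N`. -/
theorem relSpan_induction {A : Set (List I)} {N : Submodule S (List I →₀ S)}
    (F : Module.End K (List I →₀ S)) (D : S → S)
    (hF : ∀ s t, F (s • t) = s • F t + D s • t) (hAN : d.relSpan hp A ≤ N)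
    (h : ∀ v ∈ A, ∀ g ∈ d.rel hp v, F g ∈ N) {g : List I →₀ S} (hg : g ∈ d.relSpan hp A) :
    F g ∈ N := by
  refine (Submodule.span_induction (p := fun g _ => g ∈ N ∧ F g ∈ N) ?_ ?_ ?_ ?_ hg).2
  · intro g hg
    obtain ⟨v, hv, hg'⟩ := Set.mem_iUnion₂.1 hg
    exact ⟨hAN (Submodule.subset_span hg), h v hv g hg'⟩
  · exact ⟨zero_mem _, by rw [map_zero]; exact zero_mem _⟩
  · intro g g' _ _ h h'
    exact ⟨add_mem h.1 h'.1, by rw [map_add]; exact add_mem h.2 h'.2⟩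
  · intro s g _ h
    exact ⟨N.smul_mem s h.1, by rw [hF]; exact add_mem (N.smul_mem s h.2) (N.smul_mem _ h.1)⟩

theorem supported_induction {A : Set (List I)} {N M : Submodule S (List I →₀ S)}
    (F : Module.End K (List I →₀ S)) (D : S → S)
    (hF : ∀ s t, F (s • t) = s • F t + D s • t)
    (hAM : Finsupp.supported S S A ≤ M) (hMN : ∀ t ∈ M, ∀ s, D s • t ∈ N)
    (h : ∀ v ∈ A, F (Finsupp.single v 1) ∈ N) {t : List I →₀ S}
    (ht : t ∈ Finsupp.supported S S A) : F t ∈ N := by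
  rw [Finsupp.supported_eq_span_single] at ht hAM
  refine (Submodule.span_induction (p := fun g _ => g ∈ M ∧ F g ∈ N) ?_ ?_ ?_ ?_ ht).2
  · rintro _ ⟨v, hv, rfl⟩
    exact ⟨hAM (Submodule.subset_span ⟨v, hv, rfl⟩), h v hv⟩
  · exact ⟨zero_mem _, by rw [map_zero]; exact zero_mem _⟩
  · intro g g' _ _ h h'
    exact ⟨add_mem h.1 h'.1, by rw [map_add]; exact add_mem h.2 h'.2⟩
  · intro s g _ h
    exact ⟨M.smul_mem s h.1, by rw [hF]; exact add_mem (N.smul_mem s h.2) (hMN g h.1 s)⟩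

theorem single_mem_supported {A : Set (List I)} {v : List I} (hv : v ∈ A) :
    Finsupp.single v (1 : S) ∈ Finsupp.supported S S A :=
  Finsupp.single_mem_supported S _ hv

theorem map_mem_of_supported {A : Set (List I)} {N : Submodule S (List I →₀ S)}
    (F : (List I →₀ S) →ₗ[S] List I →₀ S) (h : ∀ v ∈ A, F (Finsupp.single v 1) ∈ N)
    {t : List I →₀ S} (ht : t ∈ Finsupp.supported S S A) : F t ∈ N := by
  rw [Finsupp.supported_eq_span_single] at ht
  refine Submodule.span_le (p := N.comap F) |>.2 ?_ ht
  rintro _ ⟨v, hv, rfl⟩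
  exact h v hv

/-- Evaluation of `op` at `t`, as an `R`-linear map. -/
noncomputable def opApply (d : PBWDatum p K R L S I) (t : List I →₀ S) : L →ₗ[R] List I →₀ S where
  toFun y := d.op y t
  map_add' y z := by rw [map_add, LinearMap.add_apply]
  map_smul' r y := by rw [map_smul, LinearMap.smul_apply, RingHom.id_apply]

theorem op_x_mem_relSpan {A B : Set (List I)} {i : I} (hAB : A ⊆ B) (h : ∀ v ∈ A, i :: v ∈ B)
    {g : List I →₀ S} (hg : g ∈ d.relSpan hp A) : d.op (d.x i) g ∈ d.relSpan hp B := by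
  refine relSpan_induction _ _ (d.op_smul (d.x i)) (relSpan_mono hAB) ?_ hg
  rintro v hv _ ⟨a, u, E, b, hE, rfl, rfl⟩
  exact mem_relSpan ⟨i :: a, u, E, b, hE, rfl, by rw [wordOp_cons]; rfl⟩ (h _ hv)

theorem op_mem_relSpan {A B : Set (List I)} (hAB : A ⊆ B) (h : ∀ v ∈ A, ∀ i, i :: v ∈ B)
    {g : List I →₀ S} (hg : g ∈ d.relSpan hp A) (y : L) : d.op y g ∈ d.relSpan hp B :=
  d.mem_of_forall_mem _ (opApply d g)
    (fun i => op_x_mem_relSpan hAB (fun v hv => h v hv i) hg) y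

theorem op_x_mem_supported {A B : Set (List I)} {i : I} (hAB : A ⊆ B) (h : ∀ v ∈ A, i :: v ∈ B)
    {t : List I →₀ S} (ht : t ∈ Finsupp.supported S S A) :
    d.op (d.x i) t ∈ Finsupp.supported S S B :=
  supported_induction _ _ (d.op_smul (d.x i)) (Finsupp.supported_mono hAB)
    (fun t ht s => Submodule.smul_mem _ _ ht)
    (fun v hv => by rw [op_x_single]; exact single_mem_supported (h v hv)) ht

theorem op_mem_supported {A B : Set (List I)} (hAB : A ⊆ B) (h : ∀ v ∈ A, ∀ i, i :: v ∈ B)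
    {t : List I →₀ S} (ht : t ∈ Finsupp.supported S S A) (y : L) :
    d.op y t ∈ Finsupp.supported S S B :=
  d.mem_of_forall_mem _ (opApply d t)
    (fun i => op_x_mem_supported hAB (fun v hv => h v hv i) ht) y

theorem subset_LT_cons (i : I) (w : List I) :
    {v | Word.LT v w} ⊆ {v | Word.LT v (i :: w)} := fun _ hv =>
  Or.inl (by simpa using Nat.lt_succ_of_le hv.length_le)

theorem wordOp_mem_relSpan (a : List I) {w : List I} {g : List I →₀ S}
    (hg : g ∈ d.relSpan hp {v | Word.LT v w}) :
    d.wordOp a g ∈ d.relSpan hp {v | Word.LT v (a ++ w)} := by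
  induction a with
  | nil => exact hg
  | cons i a ih =>
    rw [wordOp_cons, Module.End.mul_apply]
    exact op_x_mem_relSpan (subset_LT_cons i _) (fun v hv => Word.LT.cons hv i) ih

theorem wordOp_mem_supported (a : List I) {w : List I} {t : List I →₀ S}
    (ht : t ∈ Finsupp.supported S S {v | Word.LT v w}) :
    d.wordOp a t ∈ Finsupp.supported S S {v | Word.LT v (a ++ w)} := by
  induction a with
  | nil => exact ht
  | cons i a ih =>
    rw [wordOp_cons, Module.End.mul_apply]
    exact op_x_mem_supported (subset_LT_cons i _) (fun v hv => Word.LT.cons hv i) ih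

theorem wordOp_mem_rel (a : List I) {w : List I} {g : List I →₀ S} (hg : g ∈ d.rel hp w) :
    d.wordOp a g ∈ d.rel hp (a ++ w) := by
  obtain ⟨a', u, E, b, hE, rfl, rfl⟩ := hg
  exact ⟨a ++ a', u, E, b, hE, by simp, by rw [wordOp_append]; rfl⟩

theorem IsRedex.mem_rel {u : List I} {E : (List I →₀ S) →ₗ[S] List I →₀ S}
    (h : d.IsRedex hp u E) (b : List I) : E (Finsupp.single b 1) ∈ d.rel hp (u ++ b) :=
  ⟨[], u, E, b, h, rfl, rfl⟩

theorem relSpan_length_le {n : ℕ} {w : List I} (h : n < w.length) :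
    d.relSpan hp {v | v.length ≤ n} ≤ d.relSpan hp {v | Word.LT v w} :=
  relSpan_mono fun _ hv => Or.inl (lt_of_le_of_lt hv h)

/-- The bracket or `p`-operation term acts on `b` with words of length at most `b.length + 1`,
shorter than the redex word; the other term `j :: i :: b` has fewer inversions. -/
theorem IsRedex.single_sub_mem {u : List I} {E : (List I →₀ S) →ₗ[S] List I →₀ S}
    (h : d.IsRedex hp u E) (b : List I) :
    Finsupp.single (u ++ b) 1 - E (Finsupp.single b 1) ∈
      Finsupp.supported S S {v | Word.LT v (u ++ b)} := by
  have key : ∀ y : L, ∀ w : List I, b.length + 1 < w.length →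
      d.op y (Finsupp.single b 1) ∈ Finsupp.supported S S {v | Word.LT v w} := fun y w hw =>
    op_mem_supported (A := {b})
      (Set.singleton_subset_iff.2 (Or.inl (by omega)))
      (by rintro v rfl i; exact Or.inl (by simpa using hw)) (single_mem_supported rfl) y
  cases h with
  | lie i j hij =>
    rw [lieDefect_apply, op_x_single, op_x_single, op_x_single, op_x_single]
    simp only [List.cons_append, List.nil_append, sub_sub_cancel, sub_sub]
    exact add_mem (single_mem_supported (Word.LT_swap hij b)) (key _ _ (by simp))
  | pow i =>
    rw [powDefect_apply, ← wordOp_replicate, wordOp_single, sub_sub_cancel]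
    exact key _ _ (by have := hp.two_le; simp; omega)

theorem single_sub_mem_supported {w : List I} {g : List I →₀ S} (hg : g ∈ d.rel hp w) :
    Finsupp.single w 1 - g ∈ Finsupp.supported S S {v | Word.LT v w} := by
  obtain ⟨a, u, E, b, hE, rfl, rfl⟩ := hg
  rw [← wordOp_single (d := d), ← map_sub]
  exact wordOp_mem_supported a (hE.single_sub_mem b)

theorem IsRedex.map_mem_relSpan {u : List I} {E : (List I →₀ S) →ₗ[S] List I →₀ S}
    (h : d.IsRedex hp u E) {w : List I} {t : List I →₀ S}
    (ht : t ∈ Finsupp.supported S S {v | Word.LT v w}) :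
    E t ∈ d.relSpan hp {v | Word.LT v (u ++ w)} :=
  map_mem_of_supported E (fun v hv => mem_relSpan (h.mem_rel v) (Word.LT.append_left hv u)) ht

/-- `E` differs from the operator of `u` by operators that are shorter or have fewer inversions; on
a relation led by `w` they give relations led by words below `u ++ w`. -/
theorem IsRedex.wordOp_sub_mem {u : List I} {E : (List I →₀ S) →ₗ[S] List I →₀ S}
    (h : d.IsRedex hp u E) {w : List I} {g : List I →₀ S} (hg : g ∈ d.rel hp w) :
    d.wordOp u g - E g ∈ d.relSpan hp {v | Word.LT v (u ++ w)} := by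
  have key : ∀ y : L, ∀ w' : List I, w.length + 1 < w'.length →
      d.op y g ∈ d.relSpan hp {v | Word.LT v w'} := fun y w' hw =>
    op_mem_relSpan (A := {w})
      (Set.singleton_subset_iff.2 (Or.inl (by omega)))
      (by rintro v rfl i; exact Or.inl (by simpa using hw)) (mem_relSpan hg rfl) y
  cases h with
  | lie i j hij =>
    have : d.wordOp [i, j] g - d.lieDefect (d.x i) (d.x j) g =
        d.wordOp [j, i] g + d.op ⁅d.x i, d.x j⁆ g := by
      rw [lieDefect_apply]
      simp only [wordOp_cons, wordOp_nil, mul_one, Module.End.mul_apply]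
      abel
    rw [this]
    exact add_mem (mem_relSpan (wordOp_mem_rel _ hg) (Word.LT_swap hij w)) (key _ _ (by simp))
  | pow i =>
    rw [powDefect_apply, wordOp_replicate, sub_sub_cancel]
    exact key _ _ (by have := hp.two_le; simp; omega)

/-- Disjoint rewriting steps commute. -/
theorem IsRedex.sub_mem_of_rel {u : List I} {E : (List I →₀ S) →ₗ[S] List I →₀ S}
    (h : d.IsRedex hp u E) {w : List I} {g : List I →₀ S} (hg : g ∈ d.rel hp w) :
    E (Finsupp.single w 1) - d.wordOp u g ∈ d.relSpan hp {v | Word.LT v (u ++ w)} := by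
  have h1 := h.map_mem_relSpan (single_sub_mem_supported hg)
  rw [map_sub] at h1
  have h2 := sub_mem h1 (h.wordOp_sub_mem hg)
  convert h2 using 1
  abel

end PBWDatum

/-! ### Confluence: resolution of the overlaps. -/

namespace PBWDatum

variable {p : ℕ} {K R L S I : Type*} [CommRing K] [CommRing R] [Algebra K R] [LieRing L]
  [LieAlgebra K L] [Module R L] [LieRingModule L R] [RestrictedLieAlgebra p K L] [CommRing S]
  [Algebra R S] [Algebra K S] [IsScalarTower K R S] (d : PBWDatum p K R L S I)
  [LinearOrder I] [CharP K p] (hp : p.Prime)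

/-- The operator `W` maps combinations of words of length at most `n` to combinations of relations
with leading words of length at most `n + c`. -/
def Raises (c : ℕ) (W : Module.End K (List I →₀ S)) : Prop :=
  ∀ n, ∀ t ∈ Finsupp.supported S S {v : List I | v.length ≤ n},
    W t ∈ d.relSpan hp {v | v.length ≤ n + c}

variable {d hp}

theorem Raises.mono {c c' : ℕ} {W : Module.End K (List I →₀ S)} (hW : d.Raises hp c W)
    (h : c ≤ c') : d.Raises hp c' W := fun n t ht =>
  relSpan_mono (fun _ hv => le_trans hv (Nat.add_le_add_left h n)) (hW n t ht)

theorem Raises.add {c : ℕ} {W W' : Module.End K (List I →₀ S)} (hW : d.Raises hp c W)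
    (hW' : d.Raises hp c W') : d.Raises hp c (W + W') := fun n t ht =>
  add_mem (hW n t ht) (hW' n t ht)

theorem Raises.sub {c : ℕ} {W W' : Module.End K (List I →₀ S)} (hW : d.Raises hp c W)
    (hW' : d.Raises hp c W') : d.Raises hp c (W - W') := fun n t ht =>
  sub_mem (hW n t ht) (hW' n t ht)

theorem raises_zero (c : ℕ) : d.Raises hp c 0 := fun _ _ _ => zero_mem _

theorem Raises.comm {c : ℕ} {W : Module.End K (List I →₀ S)} (hW : d.Raises hp c W) (y : L) :
    d.Raises hp (c + 1) (d.op y * W - W * d.op y) := by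
  intro n t ht
  refine sub_mem ?_ ?_
  · rw [Module.End.mul_apply]
    refine op_mem_relSpan ?_ ?_ (hW n t ht) y
    · intro v hv; simp only [Set.mem_ofPred_eq] at hv ⊢; omega
    · intro v hv i; simp only [Set.mem_ofPred_eq, List.length_cons] at hv ⊢; omega
  · rw [Module.End.mul_apply]
    refine relSpan_mono ?_ (hW (n + 1) _ (op_mem_supported ?_ ?_ ht y))
    · intro v hv; simp only [Set.mem_ofPred_eq] at hv ⊢; omega
    · intro v hv; simp only [Set.mem_ofPred_eq] at hv ⊢; omega
    · intro v hv i; simp only [Set.mem_ofPred_eq, List.length_cons] at hv ⊢; omega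

theorem Raises.mem_of_length_lt {c : ℕ} {W : Module.End K (List I →₀ S)} (hW : d.Raises hp c W)
    {b w : List I} (h : b.length + c < w.length) :
    W (Finsupp.single b 1) ∈ d.relSpan hp {v | Word.LT v w} :=
  relSpan_length_le h (hW b.length _ (single_mem_supported (le_refl b.length)))

theorem lieDefect_self (y : L) (t : List I →₀ S) : d.lieDefect y y t = 0 := by
  rw [lieDefect_apply, lie_self, map_zero, LinearMap.zero_apply, sub_self, sub_zero]

variable [LieRinehartRing R L]

/-- By bilinearity only pairs of basis elements matter. Such a defect is a relation, its negative,
or zero, according to the order of the indices. -/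
theorem raises_lieDefect (y z : L) : d.Raises hp 2 ((d.lieDefect y z).restrictScalars K) := by
  intro n t ht
  refine map_mem_of_supported (d.lieDefect y z) (fun v hv => ?_) ht
  refine d.lieDefect_mem_of_forall_mem _ _ (fun i j => ?_) y z
  have hlen : ∀ i j : I, ([i, j] ++ v).length ≤ n + 2 := fun i j => by
    simp only [Set.mem_ofPred_eq] at hv
    simp [hv]
  rcases lt_trichotomy j i with h | rfl | h
  · exact mem_relSpan ((IsRedex.lie i j h).mem_rel v) (hlen i j)
  · rw [lieDefect_self]; exact zero_mem _
  · rw [lieDefect_swap, LinearMap.neg_apply]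
    exact neg_mem (mem_relSpan ((IsRedex.lie j i h).mem_rel v) (hlen j i))

-- `W` collects the defects of `x` with `ad(x)^k y` for `k ≥ 1`. These undergo fewer commutators
-- with `op x` than the displayed defect of `x` and `y`, so they raise lengths by less.
attribute [local instance] LieRing.ofAssociativeRing in
theorem exists_raises_ad_pow (x y : L) (n : ℕ) : ∃ W, d.Raises hp (n + 1) W ∧
    (LieAlgebra.ad K (Module.End K (List I →₀ S)) (d.op x) ^ (n + 1)) (d.op y) =
      d.op ((LieAlgebra.ad K L x ^ (n + 1)) y) +
        (LieAlgebra.ad K (Module.End K (List I →₀ S)) (d.op x) ^ n)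
          ((d.lieDefect x y).restrictScalars K) + W := by
  have key : ∀ z, LieAlgebra.ad K (Module.End K (List I →₀ S)) (d.op x) (d.op z) =
      d.op ⁅x, z⁆ + (d.lieDefect x z).restrictScalars K := by
    intro z
    refine LinearMap.ext fun t => ?_
    rw [LieAlgebra.ad_apply, Ring.lie_def, LinearMap.sub_apply, Module.End.mul_apply,
      Module.End.mul_apply, LinearMap.add_apply, LinearMap.restrictScalars_apply, lieDefect_apply]
    abel
  induction n with
  | zero => exact ⟨0, raises_zero _, by simpa using key y⟩
  | succ n ih =>
    obtain ⟨W, hW, h⟩ := ih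
    refine ⟨(d.lieDefect x ((LieAlgebra.ad K L x ^ (n + 1)) y)).restrictScalars K +
      (d.op x * W - W * d.op x), ((raises_lieDefect _ _).mono (by omega)).add (hW.comm x), ?_⟩
    have hadW : LieAlgebra.ad K (Module.End K (List I →₀ S)) (d.op x) W =
      d.op x * W - W * d.op x := rfl
    have e1 : ∀ Z, (LieAlgebra.ad K (Module.End K (List I →₀ S)) (d.op x) ^ (n + 1)) Z =
        LieAlgebra.ad K (Module.End K (List I →₀ S)) (d.op x)
          ((LieAlgebra.ad K (Module.End K (List I →₀ S)) (d.op x) ^ n) Z) := fun Z => by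
      rw [pow_succ', Module.End.mul_apply]
    have e2 : (LieAlgebra.ad K L x ^ (n + 1 + 1)) y = ⁅x, (LieAlgebra.ad K L x ^ (n + 1)) y⁆ := by
      rw [pow_succ', Module.End.mul_apply, LieAlgebra.ad_apply]
    rw [pow_succ', Module.End.mul_apply, h, map_add, map_add, key, hadW, e1, e2]
    abel

/-- The case of `p` commutators: `ad^p` becomes the commutator with the `p`-th power and `ad^(p-1)`
becomes the sum. The error `W` adds at most `p` letters, so it is negligible at overlaps, which have
`p + 1` letters before `b`. -/
theorem exists_raises_powDefect_comm (i : I) (y : L) : ∃ W, d.Raises hp p W ∧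
    ∀ t, d.powDefect hp i (d.op y t) - d.op y (d.powDefect hp i t) =
      ∑ k ∈ Finset.range p, (d.op (d.x i) ^ k)
        (d.lieDefect (d.x i) y ((d.op (d.x i) ^ (p - 1 - k)) t)) + W t := by
  have h0 := natCast_end_eq_zero K p (List I →₀ S)
  obtain ⟨W, hW, h⟩ := exists_raises_ad_pow (d := d) (hp := hp) (d.x i) y (p - 1)
  rw [Nat.sub_add_cancel hp.one_le] at hW h
  rw [LieAlgebra.ad_pow_char_apply hp h0, LieAlgebra.ad_pow_pred_char_apply hp h0,
    ← RestrictedLieAlgebra.pMap_lie] at h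
  refine ⟨W - (d.lieDefect (RestrictedLieAlgebra.pMap p K (d.x i)) y).restrictScalars K,
    hW.sub ((raises_lieDefect _ _).mono hp.two_le), fun t => ?_⟩
  have h1 := LinearMap.congr_fun h t
  rw [LinearMap.sub_apply, LinearMap.add_apply, LinearMap.add_apply, LinearMap.sum_apply] at h1
  simp only [Module.End.mul_apply, LinearMap.restrictScalars_apply] at h1
  rw [LinearMap.sub_apply, LinearMap.restrictScalars_apply,
    d.lieDefect_apply (RestrictedLieAlgebra.pMap p K (d.x i)) y, powDefect_apply,
    powDefect_apply, map_sub, ← add_sub_assoc]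
  rw [← sub_eq_zero] at h1 ⊢
  rw [← h1]
  abel

/-- Since `ad(x)^p x = 0`, the element `x^[p]` commutes with `x`; all that remains is a defect
adding at most two letters. -/
theorem powDefect_comm_self (i : I) (t : List I →₀ S) :
    d.powDefect hp i (d.op (d.x i) t) - d.op (d.x i) (d.powDefect hp i t) =
      - d.lieDefect (RestrictedLieAlgebra.pMap p K (d.x i)) (d.x i) t := by
  have h : ⁅RestrictedLieAlgebra.pMap p K (d.x i), d.x i⁆ = 0 := by
    have h0 : ∀ n ≠ 0, (LieAlgebra.ad K L (d.x i) ^ n) (d.x i) = 0 := by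
      rintro (_ | n) hn
      · exact absurd rfl hn
      · rw [pow_succ, Module.End.mul_apply, LieAlgebra.ad_apply, lie_self, map_zero]
    rw [RestrictedLieAlgebra.pMap_lie, h0 p hp.ne_zero]
  rw [lieDefect_apply, h, map_zero, LinearMap.zero_apply, powDefect_apply, powDefect_apply,
    map_sub, ← Module.End.mul_apply, ← pow_succ, pow_succ', Module.End.mul_apply]
  abel

/-- `lieDefect_jacobi` rewrites the difference by relations whose leading words permute `i, j, k`
with fewer inversions, and by defects at `b` that add only two letters. -/
theorem overlap_lie_lie {i j k : I} (hij : j < i) (hjk : k < j) (b : List I) :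
    d.lieDefect (d.x i) (d.x j) (Finsupp.single (k :: b) 1) -
      d.op (d.x i) (d.lieDefect (d.x j) (d.x k) (Finsupp.single b 1)) ∈
        d.relSpan hp {v | Word.LT v (i :: j :: k :: b)} := by
  have hz : ∀ y z : L, d.lieDefect y z (Finsupp.single b 1) ∈
      d.relSpan hp {v | Word.LT v (i :: j :: k :: b)} := fun y z =>
    (raises_lieDefect (d := d) (hp := hp) y z).mem_of_length_lt (by simp)
  have hr : ∀ i j (h : j < i) b, d.lieDefect (d.x i) (d.x j) (Finsupp.single b 1) ∈
      d.rel hp (i :: j :: b) := fun i j h b =>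
    (IsRedex.lie (d := d) (hp := hp) i j h).mem_rel b
  rw [← d.op_x_single, d.lieDefect_jacobi, d.op_x_single, d.op_x_single]
  have hik := hjk.trans hij
  have l1 : Word.LT (k :: i :: j :: b) (i :: j :: k :: b) :=
    (Word.LT_swap hik (j :: b)).trans ((Word.LT_swap hjk b).cons i)
  have l2 : Word.LT (j :: i :: k :: b) (i :: j :: k :: b) := Word.LT_swap hij (k :: b)
  have l3 : Word.LT (j :: k :: i :: b) (i :: j :: k :: b) :=
    ((Word.LT_swap hik b).cons j).trans l2
  have l4 : Word.LT (i :: k :: j :: b) (i :: j :: k :: b) := (Word.LT_swap hjk b).cons i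
  refine add_mem (sub_mem (sub_mem (add_mem (sub_mem (sub_mem ?_ ?_) ?_) ?_) (hz _ _)) (hz _ _))
    (hz _ _)
  · exact mem_relSpan (by simpa [wordOp_cons] using wordOp_mem_rel [k] (hr i j hij b)) l1
  · exact mem_relSpan (by simpa [wordOp_cons] using wordOp_mem_rel [j] (hr i k hik b)) l2
  · exact mem_relSpan (hr j k hjk _) l3
  · exact mem_relSpan (hr i k hik _) l4

theorem pow_op_lieDefect_mem_rel {i j : I} (h : j < i) (l : I) (k m : ℕ) (b : List I) :
    (d.op (d.x l) ^ k) (d.lieDefect (d.x i) (d.x j) ((d.op (d.x l) ^ m) (Finsupp.single b 1))) ∈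
      d.rel hp (List.replicate k l ++ i :: j :: (List.replicate m l ++ b)) := by
  rw [← wordOp_replicate, ← wordOp_replicate, wordOp_single]
  exact wordOp_mem_rel _ ((IsRedex.lie i j h).mem_rel _)

/-- In `∑ i^k [i, j] i^(p-1-k)` the term `k = p - 1` is the competing rewriting step. The others,
and `j` before the power relation, have the letter `j` further left, hence fewer inversions. -/
theorem overlap_pow_lie {i j : I} (h : j < i) (b : List I) :
    d.powDefect hp i (Finsupp.single (j :: b) 1) - d.wordOp (List.replicate (p - 1) i)
      (d.lieDefect (d.x i) (d.x j) (Finsupp.single b 1)) ∈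
        d.relSpan hp {v | Word.LT v (List.replicate p i ++ j :: b)} := by
  have hpp := hp.two_le
  obtain ⟨W, hW, hc⟩ := exists_raises_powDefect_comm (d := d) (hp := hp) i (d.x j)
  have h1 := hc (Finsupp.single b 1)
  rw [op_x_single] at h1
  have hsum : ∑ k ∈ Finset.range p, (d.op (d.x i) ^ k)
        (d.lieDefect (d.x i) (d.x j) ((d.op (d.x i) ^ (p - 1 - k)) (Finsupp.single b 1))) =
      ∑ k ∈ Finset.range (p - 1), (d.op (d.x i) ^ k)
        (d.lieDefect (d.x i) (d.x j) ((d.op (d.x i) ^ (p - 1 - k)) (Finsupp.single b 1))) +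
      d.wordOp (List.replicate (p - 1) i)
      (d.lieDefect (d.x i) (d.x j) (Finsupp.single b 1)) := by
    have hs := Finset.sum_range_succ (fun k => (d.op (d.x i) ^ k)
      (d.lieDefect (d.x i) (d.x j) ((d.op (d.x i) ^ (p - 1 - k)) (Finsupp.single b 1)))) (p - 1)
    rw [Nat.sub_add_cancel hp.one_le] at hs
    rw [hs, Nat.sub_self, pow_zero, Module.End.one_apply, wordOp_replicate]
  rw [hsum, sub_eq_iff_eq_add] at h1
  rw [h1]
  have h2 : W (Finsupp.single b 1) ∈ d.relSpan hp {v | Word.LT v (List.replicate p i ++ j :: b)} :=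
    hW.mem_of_length_lt (by simp; omega)
  have h3 : d.op (d.x j) (d.powDefect hp i (Finsupp.single b 1)) ∈
      d.relSpan hp {v | Word.LT v (List.replicate p i ++ j :: b)} :=
    mem_relSpan (by simpa [wordOp_cons] using
      wordOp_mem_rel [j] ((IsRedex.pow (d := d) (hp := hp) i).mem_rel b))
      (Word.LT_cons_replicate h hp.ne_zero b)
  have h4 : ∑ k ∈ Finset.range (p - 1), (d.op (d.x i) ^ k)
        (d.lieDefect (d.x i) (d.x j) ((d.op (d.x i) ^ (p - 1 - k)) (Finsupp.single b 1))) ∈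
      d.relSpan hp {v | Word.LT v (List.replicate p i ++ j :: b)} := by
    refine Submodule.sum_mem _ fun k hk => ?_
    have hk := Finset.mem_range.1 hk
    refine mem_relSpan (pow_op_lieDefect_mem_rel h i k (p - 1 - k) b) ?_
    have e2 : List.replicate p i ++ j :: b =
        List.replicate k i ++ i :: (List.replicate (p - 1 - k) i ++ j :: b) := by
      conv_lhs => rw [show p = k + ((p - 1 - k) + 1) by omega, List.replicate_add,
        List.replicate_succ]
      simp
    rw [e2]
    exact ((Word.LT_cons_replicate h (by omega) b).cons i).append_left _
  convert add_mem (add_mem h4 h2) h3 using 1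
  abel

/-- Mirror image of `overlap_pow_lie`: now the term `k = 0` is the competing step, with opposite
sign since the defect is taken of `x j` and `x i`. -/
theorem overlap_lie_pow {i j : I} (h : j < i) (b : List I) :
    d.lieDefect (d.x i) (d.x j) (Finsupp.single (List.replicate (p - 1) j ++ b) 1) -
      d.op (d.x i) (d.powDefect hp j (Finsupp.single b 1)) ∈
        d.relSpan hp {v | Word.LT v (i :: (List.replicate p j ++ b))} := by
  have hpp := hp.two_le
  obtain ⟨W, hW, hc⟩ := exists_raises_powDefect_comm (d := d) (hp := hp) j (d.x i)
  have h1 := hc (Finsupp.single b 1)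
  rw [op_x_single] at h1
  have hsum : ∑ k ∈ Finset.range p, (d.op (d.x j) ^ k)
        (d.lieDefect (d.x j) (d.x i) ((d.op (d.x j) ^ (p - 1 - k)) (Finsupp.single b 1))) =
      ∑ k ∈ Finset.range (p - 1), (d.op (d.x j) ^ (k + 1))
        (d.lieDefect (d.x j) (d.x i) ((d.op (d.x j) ^ (p - 1 - (k + 1))) (Finsupp.single b 1))) -
      d.lieDefect (d.x i) (d.x j) (Finsupp.single (List.replicate (p - 1) j ++ b) 1) := by
    have hs := Finset.sum_range_succ' (fun k => (d.op (d.x j) ^ k)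
      (d.lieDefect (d.x j) (d.x i) ((d.op (d.x j) ^ (p - 1 - k)) (Finsupp.single b 1)))) (p - 1)
    rw [Nat.sub_add_cancel hp.one_le] at hs
    rw [hs, sub_eq_add_neg, ← LinearMap.neg_apply, ← lieDefect_swap, ← wordOp_single (d := d),
      wordOp_replicate, Nat.sub_zero, pow_zero, Module.End.one_apply]
  rw [hsum] at h1
  have h2 : W (Finsupp.single b 1) ∈
      d.relSpan hp {v | Word.LT v (i :: (List.replicate p j ++ b))} :=
    hW.mem_of_length_lt (by simp; omega)
  have h3 : d.powDefect hp j (Finsupp.single (i :: b) 1) ∈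
      d.relSpan hp {v | Word.LT v (i :: (List.replicate p j ++ b))} :=
    mem_relSpan ((IsRedex.pow (d := d) (hp := hp) j).mem_rel _)
      (Word.LT_replicate_cons h hp.ne_zero b)
  have h4 : ∑ k ∈ Finset.range (p - 1), (d.op (d.x j) ^ (k + 1))
        (d.lieDefect (d.x j) (d.x i) ((d.op (d.x j) ^ (p - 1 - (k + 1))) (Finsupp.single b 1))) ∈
      d.relSpan hp {v | Word.LT v (i :: (List.replicate p j ++ b))} := by
    refine Submodule.sum_mem _ fun k hk => ?_
    have hk := Finset.mem_range.1 hk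
    rw [lieDefect_swap, LinearMap.neg_apply, map_neg]
    refine neg_mem (mem_relSpan (pow_op_lieDefect_mem_rel h j (k + 1) (p - 1 - (k + 1)) b) ?_)
    have e2 : List.replicate p j ++ b =
        List.replicate (k + 1) j ++ j :: (List.replicate (p - 1 - (k + 1)) j ++ b) := by
      conv_lhs => rw [show p = (k + 1) + ((p - 1 - (k + 1)) + 1) by omega, List.replicate_add,
        List.replicate_succ (n := p - 1 - (k + 1))]
      simp
    rw [e2]
    exact Word.LT_replicate_cons h (by omega) _
  convert sub_mem (add_mem h4 h2) h3 using 1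
  rw [sub_eq_iff_eq_add] at h1
  rw [h1]
  abel

/-- The power relation is moved past one letter `i` at a time; each move costs a defect from
`powDefect_comm_self`, supported on shorter words. -/
theorem overlap_pow_pow (i : I) (m : ℕ) (b : List I) :
    d.powDefect hp i (Finsupp.single (List.replicate m i ++ b) 1) -
      d.wordOp (List.replicate m i) (d.powDefect hp i (Finsupp.single b 1)) ∈
        d.relSpan hp {v | Word.LT v (List.replicate p i ++ (List.replicate m i ++ b))} := by
  have hpp := hp.two_le
  induction m with
  | zero => simp
  | succ m ih =>
    have e2 : List.replicate p i ++ (List.replicate (m + 1) i ++ b) =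
        i :: (List.replicate p i ++ (List.replicate m i ++ b)) := by
      rw [← List.append_assoc, ← List.replicate_add, ← List.append_assoc, ← List.replicate_add,
        ← add_assoc, List.replicate_succ]
      rfl
    have h1 := op_x_mem_relSpan (i := i) (subset_LT_cons i _)
      (fun v hv => Word.LT.cons hv i) ih
    have h2 := (raises_lieDefect (d := d) (hp := hp) (RestrictedLieAlgebra.pMap p K (d.x i))
      (d.x i)).mem_of_length_lt (b := List.replicate m i ++ b)
      (w := List.replicate p i ++ (List.replicate (m + 1) i ++ b)) (by simp; omega)
    rw [← neg_mem_iff, LinearMap.restrictScalars_apply, ← powDefect_comm_self (hp := hp)] at h2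
    rw [← e2, map_sub] at h1
    convert add_mem h1 h2 using 1
    rw [List.replicate_succ, wordOp_cons, Module.End.mul_apply, List.cons_append, op_x_single]
    abel

/-- Rewriting steps with the same leading word, one of them at the beginning of the word, agree
modulo relations with smaller leading words. -/
theorem IsRedex.sub_mem {u u' b b' c : List I} {E E' : (List I →₀ S) →ₗ[S] List I →₀ S}
    (h : d.IsRedex hp u E) (h' : d.IsRedex hp u' E') (hw : u ++ b = c ++ (u' ++ b')) :
    E (Finsupp.single b 1) - d.wordOp c (E' (Finsupp.single b' 1)) ∈
      d.relSpan hp {v | Word.LT v (u ++ b)} := by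
  have hdisj : ∀ a, c = u ++ a → b = a ++ (u' ++ b') →
      E (Finsupp.single b 1) - d.wordOp c (E' (Finsupp.single b' 1)) ∈
        d.relSpan hp {v | Word.LT v (u ++ b)} := by
    rintro a rfl rfl
    rw [wordOp_append]
    exact h.sub_mem_of_rel (wordOp_mem_rel a (h'.mem_rel b'))
  rcases List.append_eq_append_iff.1 hw with ⟨a, h1, h2⟩ | ⟨a, h1, h2⟩
  · exact hdisj a h1 h2
  -- Here `u = c ++ a`, so `a` is where the two redexes may overlap; if it is empty they are
  -- disjoint.
  · rcases eq_or_ne a [] with rfl | ha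
    · exact hdisj [] (by simpa using h1.symm) (by simpa using h2.symm)
    have hpp := hp.two_le
    have hrep : ∀ i : I, List.replicate p i = i :: i :: List.replicate (p - 2) i := fun i => by
      conv_lhs => rw [show p = (p - 2) + 1 + 1 by omega]
      rw [List.replicate_succ, List.replicate_succ]
    have hrep' : ∀ i : I, List.replicate p i = i :: List.replicate (p - 1) i := fun i => by
      conv_lhs => rw [show p = (p - 1) + 1 by omega]
      rw [List.replicate_succ]
    cases h with
    | lie i j hij =>
      rcases c with _ | ⟨i₁, _ | ⟨i₂, c⟩⟩
      · rw [List.nil_append] at h1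
        subst h1
        cases h' with
        | lie i' j' hij' =>
          simp only [List.cons_append, List.nil_append, List.cons.injEq] at h2
          obtain ⟨rfl, rfl, rfl⟩ := h2
          rw [wordOp_nil, Module.End.one_apply, sub_self]
          exact zero_mem _
        | pow i' =>
          rw [hrep] at h2
          simp only [List.cons_append, List.nil_append, List.cons.injEq] at h2
          exact absurd (h2.1.symm.trans h2.2.1) hij.ne'
      · simp only [List.cons_append, List.nil_append, List.cons.injEq] at h1
        obtain ⟨rfl, rfl⟩ := h1
        rw [wordOp_cons, wordOp_nil, mul_one]
        cases h' with
        | lie j' k hjk =>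
          simp only [List.cons_append, List.nil_append, List.cons.injEq] at h2
          obtain ⟨rfl, rfl⟩ := h2
          exact overlap_lie_lie hij hjk b'
        | pow i' =>
          rw [hrep'] at h2
          simp only [List.cons_append, List.nil_append, List.cons.injEq] at h2
          obtain ⟨rfl, rfl⟩ := h2
          have h3 := overlap_lie_pow (d := d) (hp := hp) hij b'
          rw [hrep'] at h3
          exact h3
      · simp only [List.cons_append, List.cons.injEq] at h1
        exact absurd (List.append_eq_nil_iff.1 h1.2.2.symm).2 ha
    | pow i =>
      obtain ⟨hlen, hc, ha'⟩ := List.append_eq_replicate_iff.1 h1.symm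
      generalize a.length = m' at *
      generalize c.length = m at *
      subst hc ha'
      obtain ⟨m', rfl⟩ := Nat.exists_eq_succ_of_ne_zero (n := m') (by rintro rfl; exact ha rfl)
      cases h' with
      | lie i' j' hij' =>
        rcases m' with _ | m'
        · simp only [List.replicate_succ, List.cons_append, List.nil_append, List.replicate_zero,
            List.cons.injEq] at h2
          obtain ⟨rfl, rfl⟩ := h2
          have h3 := overlap_pow_lie (d := d) (hp := hp) hij' b'
          rwa [show p - 1 = m by omega] at h3
        · simp only [List.replicate_succ, List.cons_append, List.cons.injEq] at h2
          exact absurd (h2.2.1.trans h2.1.symm) hij'.ne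
      | pow i' =>
        have hi : i' = i := by
          rw [hrep'] at h2
          simp only [List.replicate_succ, List.cons_append, List.cons.injEq] at h2
          exact h2.1
        subst hi
        rw [← hlen, Nat.add_comm m, List.replicate_add, List.append_assoc,
          List.append_cancel_left_eq] at h2
        subst h2
        exact overlap_pow_pow i' m b'

/-- The rewriting system is confluent. -/
theorem sub_mem_of_mem_rel {w : List I} {g g' : List I →₀ S} (hg : g ∈ d.rel hp w)
    (hg' : g' ∈ d.rel hp w) : g - g' ∈ d.relSpan hp {v | Word.LT v w} := by
  have key : ∀ {a c u u' b b' : List I} {E E' : (List I →₀ S) →ₗ[S] List I →₀ S},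
      d.IsRedex hp u E → d.IsRedex hp u' E' → u ++ b = c ++ (u' ++ b') →
      d.wordOp a (E (Finsupp.single b 1)) - d.wordOp (a ++ c) (E' (Finsupp.single b' 1)) ∈
        d.relSpan hp {v | Word.LT v (a ++ (u ++ b))} := by
    intro a c u u' b b' E E' h h' hw
    rw [wordOp_append, Module.End.mul_apply, ← map_sub]
    exact wordOp_mem_relSpan a (h.sub_mem h' hw)
  obtain ⟨a, u, E, b, h, rfl, rfl⟩ := hg
  obtain ⟨a', u', E', b', h', hw, rfl⟩ := hg'
  rcases List.append_eq_append_iff.1 hw with ⟨c, rfl, h2⟩ | ⟨c, rfl, h2⟩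
  · exact key h h' h2
  · rw [← neg_sub, neg_mem_iff, hw]
    exact key h' h h2

/-- The projection to the span of the irreducible words along the relations. -/
theorem exists_normalForm : ∃ N : (List I →₀ S) →ₗ[S] List I →₀ S,
    (∀ w, ∀ g ∈ d.rel hp w, N g = 0) ∧
      ∀ w, d.rel hp w = ∅ → N (Finsupp.single w 1) = Finsupp.single w 1 :=
  _root_.exists_normalForm Word.LT Word.wellFounded_LT (d.rel hp)
    (fun w g hg => by
      rw [← Finsupp.supported_eq_span_single]
      exact single_sub_mem_supported hg)
    (fun w g hg g' hg' => sub_mem_of_mem_rel hg hg')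

end PBWDatum

/-! ### Irreducible words and exponents. -/

namespace Word

variable {I : Type*} [LinearOrder I]

/-- The increasing word in which each letter `i` occurs `e i` times. -/
noncomputable def ofExponents (e : I →₀ ℕ) : List I :=
  (e.support.sort (· ≤ ·)).flatMap fun i => List.replicate (e i) i

theorem count_ofExponents (e : I →₀ ℕ) (i : I) : (ofExponents e).count i = e i := by
  have h : (List.count i ∘ fun j => List.replicate (e j) j) = fun j => if j = i then e j else 0 := by
    funext j
    simp [List.count_replicate]
  rw [ofExponents, List.count_flatMap, h, ← Multiset.sum_coe, ← Multiset.map_coe, Finset.sort_eq]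
  change ∑ j ∈ e.support, _ = _
  rw [Finset.sum_ite_eq']
  split_ifs with hi
  · rfl
  · exact (Finsupp.notMem_support_iff.1 hi).symm

theorem ofExponents_injective : Function.Injective (ofExponents (I := I)) := fun e f h => by
  ext i
  rw [← count_ofExponents, h, count_ofExponents]

theorem pairwise_ofExponents (e : I →₀ ℕ) : (ofExponents e).Pairwise (· ≤ ·) := by
  rw [ofExponents, List.pairwise_flatMap]
  refine ⟨fun i _ => by simp [List.pairwise_replicate], ?_⟩
  refine (Finset.pairwise_sort e.support (· ≤ ·)).imp fun h a ha b hb => ?_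
  rw [List.eq_of_mem_replicate ha, List.eq_of_mem_replicate hb]
  exact h

theorem ofExponents_toFinsupp {w : List I} (hw : w.Pairwise (· ≤ ·)) :
    ofExponents (Multiset.toFinsupp (w : Multiset I)) = w := by
  refine List.Perm.eq_of_pairwise (le := (· ≤ ·)) (fun a b _ _ => le_antisymm)
    (pairwise_ofExponents _) hw (List.perm_iff_count.2 fun i => ?_)
  rw [count_ofExponents, Multiset.toFinsupp_apply, Multiset.coe_count]

theorem prod_map_ofExponents {A : Type*} [Monoid A] (g : I → A) (e : I →₀ ℕ) :
    ((ofExponents e).map g).prod = ((e.support.sort (· ≤ ·)).map fun i => g i ^ e i).prod := by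
  rw [ofExponents]
  induction e.support.sort (· ≤ ·) with
  | nil => rfl
  | cons i l ih => simp [ih]

theorem exists_ofExponents_eq_append {e : I →₀ ℕ} {i : I} {n : ℕ} (hn : n ≠ 0) (h : n ≤ e i) :
    ∃ a b, ofExponents e = a ++ (List.replicate n i ++ b) := by
  have hi : i ∈ e.support.sort (· ≤ ·) := by
    rw [Finset.mem_sort, Finsupp.mem_support_iff]
    omega
  obtain ⟨l, l', hl⟩ := List.append_of_mem hi
  refine ⟨l.flatMap fun i => List.replicate (e i) i,
    List.replicate (e i - n) i ++ l'.flatMap fun i => List.replicate (e i) i, ?_⟩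
  rw [ofExponents, hl, List.flatMap_append, List.flatMap_cons, ← List.append_assoc (List.replicate n i),
    ← List.replicate_add, Nat.add_sub_cancel' h]

end Word

namespace PBWDatum

variable {p : ℕ} {K R L S I : Type*} [CommRing K] [CommRing R] [Algebra K R] [LieRing L]
  [LieAlgebra K L] [Module R L] [LieRingModule L R] [RestrictedLieAlgebra p K L] [CommRing S]
  [Algebra R S] [Algebra K S] [IsScalarTower K R S] {d : PBWDatum p K R L S I}
  [LinearOrder I] [CharP K p] {hp : p.Prime}

theorem rel_ofExponents_eq_empty {e : I →₀ ℕ} (he : ∀ i, e i < p) :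
    d.rel hp (Word.ofExponents e) = ∅ := by
  refine Set.eq_empty_of_forall_notMem ?_
  rintro _ ⟨a, u, E, b, hE, h, rfl⟩
  cases hE with
  | lie i j hij =>
    have h1 := Word.pairwise_ofExponents e
    rw [h] at h1
    have h2 := (List.pairwise_append.1 (List.pairwise_append.1 h1).2.1).1
    exact absurd hij (not_lt.2 (by simpa using h2))
  | pow i =>
    have h1 := Word.count_ofExponents e i
    rw [h, List.count_append, List.count_append, List.count_replicate_self] at h1
    have := he i
    omega

/-- A word without redex has no descent, so it is sorted and equal letters are adjacent; having no
block `i^p`, it has all multiplicities below `p`. -/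
theorem exists_eq_ofExponents {w : List I} (hw : d.rel hp w = ∅) :
    ∃ e : I →₀ ℕ, (∀ i, e i < p) ∧ Word.ofExponents e = w := by
  have hw' : ∀ a u E b, d.IsRedex hp u E → w ≠ a ++ (u ++ b) := fun a u E b hE h => by
    have : d.wordOp a (E (Finsupp.single b 1)) ∈ d.rel hp w := ⟨a, u, E, b, hE, h, rfl⟩
    rw [hw] at this
    exact this
  have h1 : w.Pairwise (· ≤ ·) := by
    rw [← List.isChain_iff_pairwise, List.isChain_iff_forall_rel_of_append_cons_cons]
    intro i j a b h
    by_contra hij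
    exact hw' a [i, j] _ b (.lie i j (not_le.1 hij)) h
  refine ⟨Multiset.toFinsupp (w : Multiset I), fun i => ?_, Word.ofExponents_toFinsupp h1⟩
  by_contra hi
  obtain ⟨a, b, h⟩ := Word.exists_ofExponents_eq_append hp.ne_zero (not_lt.1 hi)
  rw [Word.ofExponents_toFinsupp h1] at h
  exact hw' a _ _ b (.pow i) h

theorem single_mem_span_sup_relSpan (w : List I) : Finsupp.single w (1 : S) ∈
    Submodule.span S (Set.range fun e : {e : I →₀ ℕ // ∀ i, e i < p} =>
      Finsupp.single (Word.ofExponents e.1) (1 : S)) ⊔ d.relSpan hp Set.univ := by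
  have hwf := Word.wellFounded_LT (I := I)
  induction w using hwf.induction with
  | _ w ih =>
    rcases Set.eq_empty_or_nonempty (d.rel hp w) with hw | ⟨g, hg⟩
    · obtain ⟨e, he, rfl⟩ := exists_eq_ofExponents hw
      exact Submodule.mem_sup_left (Submodule.subset_span ⟨⟨e, he⟩, rfl⟩)
    · have h1 := map_mem_of_supported LinearMap.id (fun v hv => ih v hv)
        (single_sub_mem_supported hg)
      rw [← sub_add_cancel (Finsupp.single w (1 : S)) g]
      exact add_mem h1 (Submodule.mem_sup_right (mem_relSpan hg trivial))

theorem mem_span_sup_relSpan (t : List I →₀ S) : t ∈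
    Submodule.span S (Set.range fun e : {e : I →₀ ℕ // ∀ i, e i < p} =>
      Finsupp.single (Word.ofExponents e.1) (1 : S)) ⊔ d.relSpan hp Set.univ :=
  map_mem_of_supported (A := Set.univ) LinearMap.id
    (fun v _ => single_mem_span_sup_relSpan v) (by simp)

end PBWDatum

/-! ### The restricted triple acting on words modulo relations. -/

namespace PBWDatum

variable {p : ℕ} {K R L S I : Type*} [CommRing K] [CommRing R] [Algebra K R] [LieRing L]
  [LieAlgebra K L] [Module R L] [LieRingModule L R] [RestrictedLieAlgebra p K L] [CommRing S]
  [Algebra R S] [Algebra K S] [IsScalarTower K R S] (d : PBWDatum p K R L S I)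
  [LinearOrder I] [CharP K p] (hp : p.Prime)

/-- The quotient of the free `S`-module on words by the relations. -/
abbrev Quot : Type _ := (List I →₀ S) ⧸ d.relSpan hp Set.univ

/-- The operator of `y ∈ L` on the quotient by the relations. -/
noncomputable def opQuot (y : L) : Module.End K (d.Quot hp) :=
  (Submodule.Quotient.restrictScalarsEquiv K (d.relSpan hp Set.univ)).conj
    (Submodule.mapQ _ _ (d.op y) fun _ ht =>
      op_mem_relSpan (A := Set.univ) (B := Set.univ) subset_rfl (fun _ _ _ => trivial) ht y)

theorem opQuot_mk (y : L) (t : List I →₀ S) : d.opQuot hp y (Submodule.Quotient.mk t) =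
    Submodule.Quotient.mk (d.op y t) := rfl

theorem opQuot_smul (y : L) (s : S) (m : d.Quot hp) :
    d.opQuot hp y (s • m) = s • d.opQuot hp y m + d.der y s • m := by
  obtain ⟨t, rfl⟩ := Submodule.Quotient.mk_surjective _ m
  rw [← Submodule.Quotient.mk_smul, opQuot_mk, op_smul]
  rfl

/-- The action of `R` on the quotient by the relations. -/
noncomputable def smulQuot : R →ₐ[K] Module.End K (d.Quot hp) :=
  Algebra.lsmul K K (d.Quot hp)

theorem smulQuot_apply (r : R) (m : d.Quot hp) : d.smulQuot hp r m = r • m := rfl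

theorem opQuot_ring_smul (r : R) (y : L) :
    d.opQuot hp (r • y) = d.smulQuot hp r * d.opQuot hp y := by
  refine LinearMap.ext fun m => ?_
  obtain ⟨t, rfl⟩ := Submodule.Quotient.mk_surjective _ m
  rw [opQuot_mk, map_smul]
  rfl

theorem opQuot_mul_smulQuot (y : L) (r : R) : d.opQuot hp y * d.smulQuot hp r =
    d.smulQuot hp r * d.opQuot hp y + d.smulQuot hp ⁅y, r⁆ := by
  refine LinearMap.ext fun m => ?_
  rw [Module.End.mul_apply, LinearMap.add_apply, Module.End.mul_apply, smulQuot_apply,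
    smulQuot_apply, smulQuot_apply, ← algebraMap_smul S r m, opQuot_smul, der_algebraMap,
    algebraMap_smul, algebraMap_smul]

variable [LieRinehartRing R L]

theorem lieDefect_mem_relSpan (y z : L) (t : List I →₀ S) :
    d.lieDefect y z t ∈ d.relSpan hp Set.univ := by
  have ht : t ∈ Finsupp.supported S S {v : List I | v.length ≤ t.support.sup List.length} :=
    fun v hv => Finset.le_sup (f := List.length) hv
  exact relSpan_mono (Set.subset_univ _) (raises_lieDefect (d := d) (hp := hp) y z _ t ht)

theorem opQuot_pow_x (i : I) :
    d.opQuot hp (d.x i) ^ p = d.opQuot hp (RestrictedLieAlgebra.pMap p K (d.x i)) := by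
  refine LinearMap.ext fun m => ?_
  obtain ⟨t, rfl⟩ := Submodule.Quotient.mk_surjective _ m
  have h : ∀ n, (d.opQuot hp (d.x i) ^ n) (Submodule.Quotient.mk t) =
      Submodule.Quotient.mk ((d.op (d.x i) ^ n) t) := by
    intro n
    induction n with
    | zero => rfl
    | succ n ih => rw [pow_succ', pow_succ', Module.End.mul_apply, ih]; rfl
  rw [h, opQuot_mk, Submodule.Quotient.eq, ← powDefect_apply (hp := hp)]
  exact map_mem_of_supported (A := Set.univ) _
    (fun v _ => mem_relSpan ((IsRedex.pow i).mem_rel v) (Set.mem_univ _)) (by simp)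

attribute [local instance] LieRing.ofAssociativeRing in
/-- The action of `L` on the quotient by the relations. -/
noncomputable def opQuotHom [IsScalarTower K R L] : L →ₗ⁅K⁆ Module.End K (d.Quot hp) where
  toFun := d.opQuot hp
  map_add' y z := by
    refine LinearMap.ext fun m => ?_
    obtain ⟨t, rfl⟩ := Submodule.Quotient.mk_surjective _ m
    rw [opQuot_mk, map_add]
    rfl
  map_smul' a y := by
    rw [← algebraMap_smul R a y, opQuot_ring_smul, AlgHom.commutes, ← Algebra.smul_def]
    rfl
  map_lie' {y z} := by
    refine LinearMap.ext fun m => ?_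
    obtain ⟨t, rfl⟩ := Submodule.Quotient.mk_surjective _ m
    rw [Ring.lie_def]
    refine Eq.symm ((Submodule.Quotient.eq _).2 (d.lieDefect_mem_relSpan hp y z t))

theorem opQuotHom_apply [IsScalarTower K R L] (y : L) : d.opQuotHom hp y = d.opQuot hp y := rfl

variable [LieRinehartAlgebra K R L] [RestrictedLieRinehartAlgebra p K R L]

/-- Hochschild's formula for operators and the axiom for `(r y)^[p]` have the same first-order term,
which cancels. So the failure of the `p`-power relation scales by `r^p`. -/
theorem opQuot_smul_pow (r : R) (y : L) :
    d.opQuot hp (r • y) ^ p - d.opQuot hp (RestrictedLieAlgebra.pMap p K (r • y)) =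
      d.smulQuot hp (r ^ p) *
        (d.opQuot hp y ^ p - d.opQuot hp (RestrictedLieAlgebra.pMap p K y)) := by
  have hR : (p : R) = 0 := by rw [← map_natCast (algebraMap K R), CharP.cast_eq_zero, map_zero]
  have h := mul_pow_char_eq hp hR (d.smulQuot hp).toRingHom
    (LieModule.toEnd K L R y).toAddMonoidHom
    (fun a b => by simp [LieRinehartRing.leibniz_mul_right])
    (Y := d.opQuot hp y) (fun s => d.opQuot_mul_smulQuot hp y s) r
  have h2 : ∀ n, (LieModule.toEnd K L R (r • y) ^ n) r =
      (fun s => r * (LieModule.toEnd K L R y).toAddMonoidHom s)^[n] r := by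
    intro n
    induction n with
    | zero => rfl
    | succ n ih =>
      rw [pow_succ', Module.End.mul_apply, ih, Function.iterate_succ_apply']
      exact LieRinehartRing.lie_smul_eq_mul _ _ _
  have h3 : d.opQuot hp (RestrictedLieAlgebra.pMap p K (r • y)) =
      d.smulQuot hp (r ^ p) * d.opQuot hp (RestrictedLieAlgebra.pMap p K y) +
        d.smulQuot hp ((LieModule.toEnd K L R (r • y) ^ (p - 1)) r) * d.opQuot hp y := by
    rw [RestrictedLieRinehartAlgebra.pMap_smul_ring, ← opQuotHom_apply, map_add, opQuotHom_apply,
      opQuotHom_apply, opQuot_ring_smul, opQuot_ring_smul]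
  rw [h3, h2, opQuot_ring_smul]
  erw [h]
  rw [mul_sub]
  exact add_sub_add_right_eq_sub _ _ _

-- The relation holds at the `x i`; Jacobson's formula carries it to sums and `opQuot_smul_pow` to
-- multiples. From a multiple `m • y` in their span it descends to `y`, as `m^p` is invertible in
-- `S`.
attribute [local instance] LieRing.ofAssociativeRing in
theorem opQuot_pow (y : L) :
    d.opQuot hp y ^ p = d.opQuot hp (RestrictedLieAlgebra.pMap p K y) := by
  obtain ⟨m, hm, hy⟩ := d.exists_smul_mem_span y
  have h1 : d.opQuot hp (m • y) ^ p = d.opQuot hp (RestrictedLieAlgebra.pMap p K (m • y)) := by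
    generalize m • y = z at hy
    induction hy using Submodule.span_induction with
    | mem y hy =>
      obtain ⟨i, rfl⟩ := hy
      exact d.opQuot_pow_x hp i
    | zero =>
      have h0 : RestrictedLieAlgebra.pMap p K (0 : L) = 0 := by
        have := RestrictedLieAlgebra.pMap_smul (p := p) (0 : K) (0 : L)
        rwa [zero_smul, zero_pow hp.ne_zero, zero_smul] at this
      rw [h0, ← opQuotHom_apply, map_zero, zero_pow hp.ne_zero]
    | add y z _ _ hy hz =>
      rw [RestrictedLieAlgebra.pMap_add, ← opQuotHom_apply, ← opQuotHom_apply, map_add, map_add,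
        map_add, map_sum]
      have h2 := add_pow_char_eq_add_sum_restrictedCoeff (K := K) hp (d.opQuotHom hp y)
        (d.opQuotHom hp z)
      rw [h2]
      refine congrArg₂ _ (congrArg₂ _ hy hz) (Finset.sum_congr rfl fun i _ => ?_)
      exact (LieHom.map_restrictedCoeff (d.opQuotHom hp) p i y z).symm
    | smul r y _ hy =>
      rw [← sub_eq_zero, opQuot_smul_pow, hy, sub_self, mul_zero]
  rw [← sub_eq_zero, opQuot_smul_pow] at h1
  rw [← sub_eq_zero]
  refine LinearMap.ext fun t => ?_
  have h2 := LinearMap.congr_fun h1 t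
  rw [Module.End.mul_apply, smulQuot_apply, LinearMap.zero_apply, ← algebraMap_smul S, map_pow]
    at h2
  exact (hm.pow p).smul_eq_zero.1 h2

attribute [local instance] LieRing.ofAssociativeRing in
theorem isRestrictedTriple_quot : IsRestrictedTriple p K R L (d.smulQuot hp)
    (d.opQuotHom hp : L →ₗ[K] Module.End K (d.Quot hp)) where
  map_lie y z := LieHom.map_lie (d.opQuotHom hp) y z
  map_pMap y := (d.opQuot_pow hp y).symm
  map_smul r y := (d.opQuot_ring_smul hp r y).symm
  map_anchor y r := sub_eq_of_eq_add' (d.opQuot_mul_smulQuot hp y r)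

end PBWDatum

/-! ### Comparison with `S ⊗ u(R, L)` and the monomial basis. -/

open scoped TensorProduct

namespace RestrictedEnvelopingAlgebra

variable {p : ℕ} {K R L : Type*} [CommRing K] [CommRing R] [Algebra K R] [LieRing L]
  [LieAlgebra K L] [Module R L] [LieRingModule L R] [RestrictedLieAlgebra p K L]

theorem mul_induction {P : RestrictedEnvelopingAlgebra p K R L → Prop} (one : P 1)
    (add : ∀ a b, P a → P b → P (a + b)) (ring : ∀ (r : R) a, P a → P (r • a))
    (lie : ∀ (y : L) a, P a → P (ιL p K R L y * a)) (a : RestrictedEnvelopingAlgebra p K R L) : P a := by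
  suffices h : ∀ a b, P b → P (a * b) by simpa using h a 1 one
  intro a
  obtain ⟨a, rfl⟩ := RingQuot.mkAlgHom_surjective K (Rel p K R L) a
  change ∀ b, P b → P (mk p K R L a * b)
  induction a using FreeAlgebra.induction with
  | grade0 c =>
    intro b hb
    rw [AlgHom.commutes, ← (ιR p K R L).commutes, ← ring_smul_def]
    exact ring _ _ hb
  | grade1 i =>
    intro b hb
    rcases i with r | y
    · exact ring r b hb
    · exact lie y b hb
  | mul a a' h h' => intro b hb; rw [map_mul, mul_assoc]; exact h _ (h' b hb)
  | add a a' h h' => intro b hb; rw [map_add, add_mul]; exact add _ _ (h b hb) (h' b hb)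

theorem ιL_ring_smul (r : R) (y : L) : ιL p K R L (r • y) = r • ιL p K R L y :=
  ((isRestrictedTriple p K R L).map_smul r y).symm

theorem smul_mul_assoc' (r : R) (a b : RestrictedEnvelopingAlgebra p K R L) :
    r • a * b = r • (a * b) := mul_assoc _ _ _

theorem ιL_mul_smul (y : L) (r : R) (a : RestrictedEnvelopingAlgebra p K R L) :
    ιL p K R L y * r • a = r • (ιL p K R L y * a) + ⁅y, r⁆ • a := by
  simp only [ring_smul_def]
  rw [← (isRestrictedTriple p K R L).map_anchor, sub_mul, mul_assoc, mul_assoc, add_sub_cancel]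

end RestrictedEnvelopingAlgebra

namespace PBWDatum

open RestrictedEnvelopingAlgebra

variable {p : ℕ} {K R L S I : Type*} [CommRing K] [CommRing R] [Algebra K R] [LieRing L]
  [LieAlgebra K L] [Module R L] [LieRingModule L R] [RestrictedLieAlgebra p K L] [CommRing S]
  [Algebra R S] [Algebra K S] [IsScalarTower K R S] (d : PBWDatum p K R L S I)

theorem der_ring_smul (y : L) (r : R) (s : S) :
    d.der y (r • s) = r • d.der y s + ⁅y, r⁆ • s := by
  rw [Algebra.smul_def, Derivation.leibniz, der_algebraMap, algebraMap_smul, smul_eq_mul, mul_comm,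
    ← Algebra.smul_def]

/-- The action of `y ∈ L` on `S ⊗ u(R, L)`. -/
noncomputable def tensorOp (y : L) : S ⊗[R] RestrictedEnvelopingAlgebra p K R L →+
    S ⊗[R] RestrictedEnvelopingAlgebra p K R L :=
  TensorProduct.liftAddHom
    (AddMonoidHom.mk' (fun s => AddMonoidHom.mk'
      (fun a => s ⊗ₜ[R] (ιL p K R L y * a) + d.der y s ⊗ₜ[R] a)
      (fun a b => by simp only [mul_add, TensorProduct.tmul_add]; abel))
      (fun s t => by ext a; simp only [TensorProduct.add_tmul, map_add, AddMonoidHom.mk'_apply,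
        AddMonoidHom.add_apply]; abel))
    (fun r s a => by
      simp only [AddMonoidHom.mk'_apply]
      rw [der_ring_smul, ιL_mul_smul, TensorProduct.tmul_add, TensorProduct.add_tmul,
        TensorProduct.smul_tmul, TensorProduct.smul_tmul, TensorProduct.smul_tmul]
      abel)

theorem tensorOp_tmul (y : L) (s : S) (a : RestrictedEnvelopingAlgebra p K R L) :
    d.tensorOp y (s ⊗ₜ a) = s ⊗ₜ[R] (ιL p K R L y * a) + d.der y s ⊗ₜ[R] a := rfl

/-- `tensorOp` evaluated at `c`, as an `R`-linear map. -/
noncomputable def tensorOpApply (c : S ⊗[R] RestrictedEnvelopingAlgebra p K R L) :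
    L →ₗ[R] S ⊗[R] RestrictedEnvelopingAlgebra p K R L where
  toFun y := d.tensorOp y c
  map_add' y z := by
    induction c with
    | zero => simp
    | add c c' h h' => simp only [map_add, h, h']; abel
    | tmul t a =>
      simp only [tensorOp_tmul, map_add, add_mul, TensorProduct.tmul_add, TensorProduct.add_tmul,
        Derivation.add_apply]
      abel
  map_smul' r y := by
    induction c with
    | zero => simp
    | add c c' h h' => simp only [map_add, smul_add, h, h']
    | tmul t a =>
      rw [tensorOp_tmul, tensorOp_tmul, ιL_ring_smul, smul_mul_assoc', map_smul,
        TensorProduct.tmul_smul, RingHom.id_apply, smul_add, TensorProduct.smul_tmul']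
      rfl

/-- The map from the free `S`-module on words sending a word to the corresponding monomial. -/
noncomputable def toTensor : (List I →₀ S) →ₗ[S] S ⊗[R] RestrictedEnvelopingAlgebra p K R L :=
  Finsupp.linearCombination S fun w => (1 : S) ⊗ₜ[R] (w.map fun i => ιL p K R L (d.x i)).prod

theorem toTensor_single (w : List I) (s : S) : d.toTensor (Finsupp.single w s) =
    s ⊗ₜ[R] (w.map fun i => ιL p K R L (d.x i)).prod := by
  rw [toTensor, Finsupp.linearCombination_single, TensorProduct.smul_tmul', smul_eq_mul, mul_one]

theorem toTensor_op (y : L) (t : List I →₀ S) :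
    d.toTensor (d.op y t) = d.tensorOp y (d.toTensor t) := by
  have h := d.mem_of_forall_mem (⊥ : Submodule S (S ⊗[R] RestrictedEnvelopingAlgebra p K R L))
    ((d.toTensor.restrictScalars R) ∘ₗ opApply d t - d.tensorOpApply (d.toTensor t))
    (fun i => ?_) y
  · rw [Submodule.mem_bot] at h
    exact sub_eq_zero.1 h
  rw [Submodule.mem_bot, LinearMap.sub_apply, sub_eq_zero]
  change d.toTensor (d.op (d.x i) t) = d.tensorOp (d.x i) (d.toTensor t)
  induction t using Finsupp.induction_linear with
  | zero => simp
  | add t t' h h' => simp only [map_add, h, h']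
  | single w s =>
    rw [op_single, map_add, map_smul, coord_x, Finsupp.mapDomain_single, toTensor_single,
      toTensor_single, toTensor_single, tensorOp_tmul, TensorProduct.smul_tmul', smul_eq_mul,
      mul_one, List.map_cons, List.prod_cons]

/-- The range is stable under `tensorOp`, and `s ⊗ y a` is `tensorOp y (s ⊗ a)` minus `der y s ⊗ a`;
so induction on `a` applies. -/
theorem toTensor_surjective : Function.Surjective d.toTensor := by
  rw [← LinearMap.range_eq_top, eq_top_iff]
  have h : ∀ a : RestrictedEnvelopingAlgebra p K R L, ∀ s : S,
      s ⊗ₜ[R] a ∈ LinearMap.range d.toTensor := by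
    intro a
    induction a using mul_induction with
    | one => exact fun s => ⟨Finsupp.single [] s, by rw [toTensor_single]; rfl⟩
    | add a b ha hb => intro s; rw [TensorProduct.tmul_add]; exact add_mem (ha s) (hb s)
    | ring r a ha => intro s; rw [← TensorProduct.smul_tmul]; exact ha _
    | lie y a ha =>
      intro s
      obtain ⟨t, ht⟩ := ha s
      rw [← add_sub_cancel_right (s ⊗ₜ[R] (ιL p K R L y * a)) (d.der y s ⊗ₜ[R] a),
        ← tensorOp_tmul, ← ht, ← toTensor_op]
      exact sub_mem ⟨_, rfl⟩ (ha _)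
  intro c _
  induction c with
  | zero => exact zero_mem _
  | add c c' h h' => exact add_mem (h trivial) (h' trivial)
  | tmul s a => exact h a s

variable [LinearOrder I] [CharP K p] (hp : p.Prime)

theorem toTensor_eq_zero_of_mem_rel {w : List I} {g : List I →₀ S} (hg : g ∈ d.rel hp w) :
    d.toTensor g = 0 := by
  obtain ⟨a, u, E, b, hE, rfl, rfl⟩ := hg
  induction a with
  | nil =>
    rw [wordOp_nil, Module.End.one_apply]
    have h : ∀ y, d.toTensor (d.op y (Finsupp.single b 1)) =
        1 ⊗ₜ[R] (ιL p K R L y * (b.map fun i => ιL p K R L (d.x i)).prod) := fun y => by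
      rw [toTensor_op, toTensor_single, tensorOp_tmul, Derivation.map_one_eq_zero,
        TensorProduct.zero_tmul, add_zero]
    cases hE with
    | lie i j hij =>
      rw [lieDefect_apply, map_sub, map_sub, h, op_x_single, op_x_single, op_x_single,
        op_x_single, toTensor_single, toTensor_single, ← TensorProduct.tmul_sub,
        ← TensorProduct.tmul_sub, (isRestrictedTriple p K R L).map_lie]
      simp [sub_mul, mul_assoc]
    | pow i =>
      rw [powDefect_apply, map_sub, h, ← wordOp_replicate, wordOp_single, toTensor_single,
        ← TensorProduct.tmul_sub, (isRestrictedTriple p K R L).map_pMap]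
      simp
  | cons i a ih =>
    rw [wordOp_cons, Module.End.mul_apply, toTensor_op, ih, map_zero]

variable [LieRinehartRing R L] [LieRinehartAlgebra K R L] [RestrictedLieRinehartAlgebra p K R L]

/-- The monomials are independent modulo the relations. -/
theorem exists_toQuot : ∃ F : S ⊗[R] RestrictedEnvelopingAlgebra p K R L →ₗ[S] d.Quot hp,
    ∀ t, F (d.toTensor t) = Submodule.Quotient.mk t := by
  obtain ⟨φ, ⟨hR, hL⟩, -⟩ := existsUnique_lift p (d.isRestrictedTriple_quot hp)
  -- The action on the empty word sends each monomial in the `x i` to the class of its word.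
  let ψ : RestrictedEnvelopingAlgebra p K R L →ₗ[R] d.Quot hp :=
    { toFun := fun a => φ a (Submodule.Quotient.mk (Finsupp.single [] 1))
      map_add' := fun a b => by rw [map_add, LinearMap.add_apply]
      map_smul' := fun r a => by
        rw [ring_smul_def, map_mul, hR, Module.End.mul_apply, smulQuot_apply, RingHom.id_apply] }
  refine ⟨ψ.liftBaseChange S, fun t => ?_⟩
  have h : ψ.liftBaseChange S ∘ₗ d.toTensor = Submodule.mkQ _ := by
    refine Finsupp.lhom_ext' fun w => LinearMap.ext_ring ?_
    rw [LinearMap.comp_apply, LinearMap.comp_apply, LinearMap.comp_apply, Finsupp.lsingle_apply,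
      toTensor_single, LinearMap.liftBaseChange_tmul, one_smul]
    induction w with
    | nil => change φ 1 _ = _; rw [map_one]; rfl
    | cons i w ih =>
      rw [List.map_cons, List.prod_cons]
      change φ (_ * _) _ = _
      rw [map_mul, Module.End.mul_apply]
      erw [ih, hL]
      change d.opQuot hp (d.x i) (Submodule.Quotient.mk _) = _
      rw [opQuot_mk, op_x_single]
      rfl
  exact LinearMap.congr_fun h t

/-- The ordered monomials form a basis of `S ⊗ u(R, L)`. -/
theorem exists_basis (hp : p.Prime) : ∃ B : Module.Basis {e : I →₀ ℕ // ∀ i, e i < p} S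
    (S ⊗[R] RestrictedEnvelopingAlgebra p K R L),
    ∀ e, B e = 1 ⊗ₜ[R] orderedMonomial p K R d.x e.1 := by
  let v : {e : I →₀ ℕ // ∀ i, e i < p} → List I →₀ S := fun e =>
    Finsupp.single (Word.ofExponents e.1) 1
  have hv : ∀ e, d.toTensor (v e) = 1 ⊗ₜ[R] orderedMonomial p K R d.x e.1 := fun e => by
    rw [toTensor_single, Word.prod_map_ofExponents]
    rfl
  obtain ⟨N, hN0, hN⟩ := exists_normalForm (d := d) (hp := hp)
  obtain ⟨F, hF⟩ := d.exists_toQuot hp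
  have hNle : d.relSpan hp Set.univ ≤ LinearMap.ker N := by
    refine Submodule.span_le.2 fun g hg => ?_
    obtain ⟨w, -, hg⟩ := Set.mem_iUnion₂.1 hg
    exact hN0 w g hg
  have hle : d.relSpan hp Set.univ ≤ LinearMap.ker d.toTensor := by
    refine Submodule.span_le.2 fun g hg => ?_
    obtain ⟨w, -, hg⟩ := Set.mem_iUnion₂.1 hg
    exact d.toTensor_eq_zero_of_mem_rel hp hg
  -- The map to the quotient followed by the normal form takes the ordered monomials back to
  -- distinct basis words.
  have hli : LinearIndependent S fun e => d.toTensor (v e) := by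
    refine LinearIndependent.of_comp ((Submodule.liftQ _ N hNle) ∘ₗ F) ?_
    have h : (((Submodule.liftQ _ N hNle) ∘ₗ F) ∘ fun e => d.toTensor (v e)) = v := by
      funext e
      rw [Function.comp_apply, LinearMap.comp_apply, hF]
      exact hN _ (rel_ofExponents_eq_empty e.2)
    rw [h]
    exact (Finsupp.linearIndependent_single_one S (List I)).comp _
      (Word.ofExponents_injective.comp Subtype.val_injective)
  have hsp : ⊤ ≤ Submodule.span S (Set.range fun e => d.toTensor (v e)) := by
    intro c _
    obtain ⟨t, rfl⟩ := d.toTensor_surjective c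
    obtain ⟨t₁, h₁, t₂, h₂, rfl⟩ := Submodule.mem_sup.1 (mem_span_sup_relSpan (d := d) (hp := hp) t)
    have h2 : d.toTensor t₂ = 0 := hle h₂
    rw [map_add, h2, add_zero]
    have := Submodule.mem_map_of_mem (f := d.toTensor) h₁
    rw [Submodule.map_span, ← Set.range_comp] at this
    exact this
  exact ⟨Module.Basis.mk hli hsp, fun e => by rw [Module.Basis.mk_apply, hv]⟩

end PBWDatum

/-! ### Extending the anchor to localizations. -/

section DerivationLocalization

variable {K R S : Type*} [CommRing K] [CommRing R] [CommRing S] [Algebra K R] [Algebra R S]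
  [Algebra K S] [IsScalarTower K R S]

/-- For formally étale `S`, the differentials of `S` are those of `R` extended to `S`, so a
derivation extends by base change. -/
theorem Derivation.exists_extension_of_formallyEtale [Algebra.FormallyEtale R S]
    (δ : Derivation K R S) : ∃ D : Derivation K S S, ∀ r, D (algebraMap R S r) = δ r := by
  let e := KaehlerDifferential.tensorKaehlerEquivOfFormallyEtale K R S
  refine ⟨((δ.liftKaehlerDifferential.liftBaseChange S) ∘ₗ e.symm.toLinearMap).compDer
    (KaehlerDifferential.D K S), fun r => ?_⟩
  have h : KaehlerDifferential.D K S (algebraMap R S r) =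
      e (1 ⊗ₜ KaehlerDifferential.D K R r) := by
    rw [KaehlerDifferential.tensorKaehlerEquivOfFormallyEtale_apply,
      KaehlerDifferential.mapBaseChange_tmul, one_smul, KaehlerDifferential.map_D]
  change δ.liftKaehlerDifferential.liftBaseChange S
    (e.symm (KaehlerDifferential.D K S (algebraMap R S r))) = _
  rw [h, LinearEquiv.symm_apply_apply, LinearMap.liftBaseChange_tmul, one_smul,
    Derivation.liftKaehlerDifferential_comp_D]

theorem IsLocalization.eq_of_leibniz (N : Submonoid R) [IsLocalization N S] {D D' : S → S}
    (hD : ∀ a b, D (a * b) = a * D b + D a * b) (hD' : ∀ a b, D' (a * b) = a * D' b + D' a * b)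
    (h : ∀ r, D (algebraMap R S r) = D' (algebraMap R S r)) (s : S) : D s = D' s := by
  obtain ⟨⟨r, m⟩, hs⟩ := IsLocalization.surj N s
  have h1 := h r
  rw [← hs, hD, hD', h, add_right_inj] at h1
  exact (IsLocalization.map_units S m).mul_left_injective h1

theorem Derivation.map_mul_eq_mul_add_mul (D : Derivation K S S) (a b : S) :
    D (a * b) = a * D b + D a * b := by
  rw [Derivation.leibniz, smul_eq_mul, smul_eq_mul, mul_comm b]

end DerivationLocalization

namespace PBWDatum

variable {p : ℕ} {K R L S I V : Type*} [CommRing K] [CharP K p] [CommRing R] [Algebra K R]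
  [LieRing L] [LieAlgebra K L] [Module R L] [LieRingModule L R] [LieRinehartRing R L]
  [RestrictedLieAlgebra p K L] [CommRing S] [Algebra R S] [Algebra K S]

/-- The anchor is not assumed to respect `p`-operations. Expanding `ad(y)^p (r • z) = ⁅y^[p], r •
z⁆` in two ways shows that it does so after acting on `L`; a basis element as `z` then removes the
restriction, as `der_pMap` requires. -/
theorem lie_pMap_smul [LieRinehartAlgebra K R L] (hp : p.Prime) (y z : L) (r : R) :
    ⁅RestrictedLieAlgebra.pMap p K y, r⁆ • z = (fun s => ⁅y, s⁆)^[p] r • z := by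
  have h := pow_char_mul_eq_of_leibniz hp (natCast_end_eq_zero K p L)
    (Algebra.lsmul K K L : R →ₐ[K] Module.End K L) (fun s => ⁅y, s⁆) (Y := LieAlgebra.ad K L y)
    (fun s => LinearMap.ext fun z => LieRinehartRing.leibniz_smul_right y z s) r
  have h1 := LinearMap.congr_fun h z
  rw [Module.End.mul_apply, LinearMap.add_apply, Module.End.mul_apply] at h1
  simp only [Algebra.lsmul_coe] at h1
  rw [← RestrictedLieAlgebra.pMap_lie, ← RestrictedLieAlgebra.pMap_lie,
    LieRinehartRing.leibniz_smul_right] at h1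
  exact add_left_cancel h1

/-- A family which becomes a basis after localization gives a `PBWDatum`. -/
theorem exists_of_isLocalization [IsScalarTower K R S] [LieRinehartAlgebra K R L] (hp : p.Prime)
    (N : Submonoid R) [IsLocalization N S] [AddCommGroup V] [Module R V] [Module S V]
    [IsScalarTower R S V] (f : L →ₗ[R] V) [IsLocalizedModule N f] (x : I → L)
    (b : Module.Basis I S V) (hb : ∀ i, b i = f (x i)) :
    ∃ d : PBWDatum p K R L S I, d.x = x := by
  have := Algebra.FormallyEtale.of_isLocalization (Rₘ := S) N
  choose D hD using fun y : L => Derivation.exists_extension_of_formallyEtale (S := S)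
    ((Algebra.linearMap R S).compDer (LieRinehartAlgebra.anchor K R L y))
  have hD' : ∀ y r, D y (algebraMap R S r) = algebraMap R S ⁅y, r⁆ := hD
  have hext : ∀ D₁ D₂ : Derivation K S S,
      (∀ r, D₁ (algebraMap R S r) = D₂ (algebraMap R S r)) → D₁ = D₂ := fun D₁ D₂ h =>
    Derivation.ext fun s => IsLocalization.eq_of_leibniz N D₁.map_mul_eq_mul_add_mul
      D₂.map_mul_eq_mul_add_mul h s
  have hS : (p : S) = 0 := by rw [← map_natCast (algebraMap K S), CharP.cast_eq_zero, map_zero]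
  refine ⟨{
    x := x
    coord := (b.repr.toLinearMap.restrictScalars R) ∘ₗ f
    coord_x := fun i => ?_
    exists_smul_mem_span := fun y => ?_
    der :=
      { toFun := D
        map_add' := fun y z => hext _ _ fun r => ?_
        map_smul' := fun a y => hext _ _ fun r => ?_ }
    der_algebraMap := hD'
    der_lie := fun y z => hext _ _ fun r => ?_
    der_pMap := fun i => IsLocalization.eq_of_leibniz N (D _).map_mul_eq_mul_add_mul
      (AddMonoidHom.iterate_char_mul_of_leibniz hp hS (D (x i) : S →ₗ[K] S).toAddMonoidHom
        (D (x i)).map_mul_eq_mul_add_mul) fun r => ?_ }, rfl⟩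
  · change b.repr (f (x i)) = _
    rw [← hb, b.repr_self]
  -- The localized span is everything, and clearing denominators moves a multiple of `y` into the
  -- span itself.
  · have h1 : f y ∈ (Submodule.span R (Set.range x)).localized' S N f := by
      rw [Submodule.localized'_span, ← Set.range_comp]
      have : (f ∘ x) = b := funext fun i => (hb i).symm
      rw [this, b.span_eq]
      trivial
    obtain ⟨z, hz, m, hm⟩ := (Submodule.mem_localized' S N f _ _).1 h1
    rw [IsLocalizedModule.mk'_eq_iff] at hm
    have hm' : f z = f (m • y) := by rw [hm]; exact (map_smul f (m : R) y).symm
    obtain ⟨c, hc⟩ := (IsLocalizedModule.eq_iff_exists N f).1 hm'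
    refine ⟨(c * m : N), IsLocalization.map_units S _, ?_⟩
    have : ((c * m : N) : R) • y = c • m • y :=
      mul_smul (c : R) (m : R) y
    rw [this, ← hc]
    exact Submodule.smul_mem _ (c : R) hz
  · rw [Derivation.add_apply, hD', hD', hD', add_lie, map_add]
  · rw [RingHom.id_apply, Derivation.smul_apply, hD', hD', LieRinehartRing.lie_smul_eq_mul, map_mul,
      Algebra.smul_def]
  · change D _ _ = ⁅D y, D z⁆ _
    rw [Derivation.commutator_apply, hD', hD', hD', hD', hD', lie_lie, map_sub]
  · have h2 : ∀ n, (D (x i))^[n] (algebraMap R S r) =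
        algebraMap R S ((fun s => ⁅x i, s⁆)^[n] r) := fun n => by
      induction n with
      | zero => rfl
      | succ n ih => rw [Function.iterate_succ_apply', ih, hD', Function.iterate_succ_apply']
    change D _ _ = (D (x i))^[p] (algebraMap R S r)
    rw [h2, hD']
    -- The `i`-th coordinate of `a • x i` is the image of `a` in `S`, so the identity on `x i`
    -- becomes one in `S`.
    have h3 := congrArg (fun z => b.repr (f z) i) (lie_pMap_smul (K := K) hp (x i) (x i) r)
    have h4 : ∀ a : R, b.repr (f (a • x i)) i = algebraMap R S a := fun a => by
      rw [map_smul, ← hb, ← algebraMap_smul S a, map_smul, b.repr_self, Finsupp.smul_single,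
        Finsupp.single_eq_same, smul_eq_mul, mul_one]
    simpa only [h4] using h3

end PBWDatum

/-! ### Free, projective and finitely generated projective `L`. -/

namespace RestrictedEnvelopingAlgebra

variable (p : ℕ) [Fact p.Prime] (K R L : Type*) [CommRing K] [CharP K p] [CommRing R] [Algebra K R]
  [LieRing L] [LieAlgebra K L] [Module R L] [LieRingModule L R] [LieRinehartRing R L]
  [LieRinehartAlgebra K R L] [RestrictedLieAlgebra p K L] [RestrictedLieRinehartAlgebra p K R L]

theorem exists_basis_orderedMonomial (I : Type*) [LinearOrder I] (x : Module.Basis I R L) :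
    ∃ B : Module.Basis {e : I →₀ ℕ // ∀ i, e i < p} R (RestrictedEnvelopingAlgebra p K R L),
      ∀ e, B e = orderedMonomial p K R x e.1 := by
  have hp : p.Prime := Fact.out
  have : IsLocalization (⊥ : Submonoid R) R := IsLocalization.self bot_le
  have : IsLocalizedModule (⊥ : Submonoid R) (LinearMap.id : L →ₗ[R] L) :=
    isLocalizedModule_id _ _ R
  obtain ⟨d, hd⟩ := PBWDatum.exists_of_isLocalization (K := K) hp (⊥ : Submonoid R)
    (LinearMap.id : L →ₗ[R] L) x x (fun _ => rfl)
  obtain ⟨B, hB⟩ := d.exists_basis hp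
  refine ⟨B.map (TensorProduct.lid R _), fun e => ?_⟩
  rw [Module.Basis.map_apply, hB, TensorProduct.lid_tmul, one_smul, hd]

variable {R}

/-- Multiplying each basis vector by its denominator, a unit of the localization, gives a basis
coming from `L`; any linear order on the index set will do. With finitely many indices there are
finitely many exponents below `p`. -/
theorem free_localizedModule (N : Submonoid R)
    [Module.Free (Localization N) (LocalizedModule N L)] :
    Module.Free (Localization N) (LocalizedModule N (RestrictedEnvelopingAlgebra p K R L)) ∧
      (Module.Finite (Localization N) (LocalizedModule N L) →
        Module.Finite (Localization N)
          (LocalizedModule N (RestrictedEnvelopingAlgebra p K R L))) := by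
  have hp : p.Prime := Fact.out
  let I := Module.Free.ChooseBasisIndex (Localization N) (LocalizedModule N L)
  let b : Module.Basis I _ _ := Module.Free.chooseBasis (Localization N) (LocalizedModule N L)
  let f := LocalizedModule.mkLinearMap N L
  let _ : LinearOrder I := IsWellOrder.linearOrder WellOrderingRel
  have hb : ∀ i, ∃ (y : L) (m : N), IsLocalizedModule.mk' f y m = b i := fun i => by
    obtain ⟨⟨y, m⟩, h⟩ := IsLocalizedModule.mk'_surjective N f (b i)
    exact ⟨y, m, h⟩
  choose x m hx using hb
  have hu : ∀ i, IsUnit (algebraMap R (Localization N) (m i)) := fun i =>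
    IsLocalization.map_units _ (m i)
  obtain ⟨d, -⟩ := PBWDatum.exists_of_isLocalization (K := K) (p := p) hp N f x
    (b.isUnitSMul hu) fun i => by
      rw [Module.Basis.isUnitSMul_apply, algebraMap_smul, ← hx]
      exact IsLocalizedModule.mk'_cancel' f (x i) (m i)
  obtain ⟨B, -⟩ := d.exists_basis hp
  let B' := B.map (LocalizedModule.equivTensorProduct N
    (RestrictedEnvelopingAlgebra p K R L)).symm
  refine ⟨Module.Free.of_basis B', fun h => ?_⟩
  -- Over the zero ring a basis of a finite module may be infinite, so this case is separate.
  rcases subsingleton_or_nontrivial (Localization N) with hS | hS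
  · have := Module.subsingleton (Localization N)
      (LocalizedModule N (RestrictedEnvelopingAlgebra p K R L))
    infer_instance
  have : Finite I := Module.Finite.finite_basis b
  have : Finite {e : I →₀ ℕ // ∀ i, e i < p} :=
    Finite.of_injective (fun e i => (⟨e.1 i, e.2 i⟩ : Fin p)) fun e e' h =>
      Subtype.ext (Finsupp.ext fun i => congrArg Fin.val (congrFun h i))
  exact Module.Finite.of_basis B'

theorem projective_localizedModule {M : Type*} [AddCommGroup M] [Module R M] [Module.Projective R M]
    (N : Submonoid R) : Module.Projective (Localization N) (LocalizedModule N M) :=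
  Module.Projective.of_equiv (LocalizedModule.equivTensorProduct N M).symm

theorem isLocallyFreeModule [Module.Projective R L] :
    IsLocallyFreeModule R (RestrictedEnvelopingAlgebra p K R L) := fun P _ => by
  have := projective_localizedModule (M := L) P.primeCompl
  have : Module.Free (Localization P.primeCompl) (LocalizedModule P.primeCompl L) :=
    Module.free_of_projective_of_isLocalRing (R := Localization.AtPrime P)
  exact (free_localizedModule p K L P.primeCompl).1

/-- At every maximal ideal `L` is free, and finite presentation spreads this to some `r` outside it;
such `r` generate the unit ideal, and finite presentation may be checked after inverting them. -/
theorem finitePresentation [Module.Finite R L] [Module.Projective R L] :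
    Module.FinitePresentation R (RestrictedEnvelopingAlgebra p K R L) := by
  have := Module.finitePresentation_of_projective R L
  let s : Set R := {r | Module.Free (Localization (Submonoid.powers r)) (LocalizedModule.Away r L)}
  have hs : Ideal.span s = ⊤ := by
    by_contra h
    obtain ⟨P, hP, hle⟩ := Ideal.exists_le_maximal _ h
    have := projective_localizedModule (M := L) P.primeCompl
    have : Module.Free (Localization P.primeCompl) (LocalizedModule P.primeCompl L) :=
      Module.free_of_projective_of_isLocalRing (R := Localization.AtPrime P)
    have : Nontrivial (Localization P.primeCompl) :=
      inferInstanceAs (Nontrivial (Localization.AtPrime P))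
    obtain ⟨r, hr, hfree, -⟩ := Module.FinitePresentation.exists_free_localizedModule_powers
      P.primeCompl (LocalizedModule.mkLinearMap P.primeCompl L) (Localization P.primeCompl)
    exact hr (hle (Ideal.subset_span hfree))
  refine Module.FinitePresentation.of_localizationSpan s hs fun ⟨r, hr⟩ => ?_
  have : Module.Free (Localization (Submonoid.powers r)) (LocalizedModule (.powers r) L) := hr
  have hfin : Module.Finite (Localization (Submonoid.powers r)) (LocalizedModule (.powers r) L) :=
    Module.Finite.of_isLocalizedModule (Submonoid.powers r)
      (LocalizedModule.mkLinearMap (Submonoid.powers r) L)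
  obtain ⟨h1, h2⟩ := free_localizedModule p K L (Submonoid.powers r)
  have := h2 hfin
  exact Module.finitePresentation_of_projective (Localization (Submonoid.powers r))
    (LocalizedModule (.powers r) (RestrictedEnvelopingAlgebra p K R L))

/-- For a finitely presented module projectivity can be tested at maximal ideals, where `u(R, L)` is
free. -/
theorem projective [Module.Finite R L] [Module.Projective R L] :
    Module.Projective R (RestrictedEnvelopingAlgebra p K R L) := by
  have := finitePresentation p K (R := R) L
  refine Module.projective_of_localization_maximal fun P _ => ?_
  have := isLocallyFreeModule p K (R := R) L P
  exact Module.Projective.of_free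

end RestrictedEnvelopingAlgebra

theorem mainTheorem1 (p : ℕ) [Fact p.Prime] (K R L : Type*) [CommRing K] [CharP K p]
    [CommRing R] [Algebra K R] [LieRing L] [LieAlgebra K L] [Module R L] [LieRingModule L R]
    [LieRinehartRing R L] [LieRinehartAlgebra K R L]
    [RestrictedLieAlgebra p K L] [RestrictedLieRinehartAlgebra p K R L] :
    (∀ (I : Type*) [LinearOrder I] (x : Module.Basis I R L),
      ∃ B : Module.Basis {e : I →₀ ℕ // ∀ i, e i < p} R (RestrictedEnvelopingAlgebra p K R L),
        ∀ e, B e = RestrictedEnvelopingAlgebra.orderedMonomial p K R x e.1) ∧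
    (Module.Projective R L →
      IsLocallyFreeModule R (RestrictedEnvelopingAlgebra p K R L)) ∧
    (Module.Finite R L → Module.Projective R L →
      Module.Finite R (RestrictedEnvelopingAlgebra p K R L) ∧
        Module.Projective R (RestrictedEnvelopingAlgebra p K R L)) := by
  refine ⟨fun I _ x => RestrictedEnvelopingAlgebra.exists_basis_orderedMonomial p K R L I x,
    fun _ => RestrictedEnvelopingAlgebra.isLocallyFreeModule p K L, fun _ _ => ⟨?_, ?_⟩⟩
  · have := RestrictedEnvelopingAlgebra.finitePresentation p K (R := R) L
    infer_instance
  · exact RestrictedEnvelopingAlgebra.projective p K L
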